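/- **Setting.** There are $m$ machines; a fraction $\alpha$ of them (the set $\mathcal B$) is Byzantine. The normal machines are partitioned into $k\ge 2$ nonempty clusters $S_1^*,\dots,S_k^*$. Machine $i\in S_j^*$ draws $n_i\ge1$ i.i.d. points from $\mathcal D_j^*$ for each batch of data. There are $b$ mutually independent batches, and iteration $t$ uses one batch for estimating clusters and one for computing gradients, according to any fixed schedule ($b=1$: the same data in every iteration; $b=2T$ with all batches different: re-sampling). Put $n_{min}=\min_{i\notin\mathcal B}n_i$, $N=\sum_{i\notin\mathcal B}n_i$, $p=\min_j|S_j^*|/m$. The loss is $f(\theta;z)$, $\theta\in\mathbb R^d$; $\Theta\subset\mathbb R^d$ is convex and compact with diameter $D$; $F^j(\theta)=\mathbb E_{z\sim\mathcal D_j^*}f(\theta;z)$; $\theta_j^*=\arg\min_{\Theta}F^j$, with $\nabla F^j(\theta_j^*)=0$; $\Delta=\min_{j\ne j'}\|\theta_j^*-\theta_{j'}^*\|$; $\|\cdot\|$ is the Euclidean norm. **Algorithm** (Byzantine-robust IFCA with trimmed mean). From $\theta^{(0)}_1,\dots,\theta^{(0)}_k\in\Theta$, at step $t$ each normal machine $i$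 sends some $\hat\jmath_i\in\arg\min_jF_i(\theta_j^{(t)})$ and $g_i=\nabla F_i(\theta^{(t)}_{\hat\jmath_i})$, where $F_i$ is the empirical loss on its current batch; Byzantine machines send an arbitrary $\hat\jmath_i\in[k]$ and an arbitrary vector $g_i$ (they may know all the data). Then $\theta_j^{(t+1)}=\Pi_\Theta\big(\theta_j^{(t)}-\tfrac1{L_F}\,\mathrm{trmean}_\beta\{g_i:\hat\jmath_i=j\}\big)$, where $\mathrm{trmean}_\beta$ of $q$ vectors removes, in each coordinate, the $\lfloor\beta q\rfloor$ largest and the $\lfloor\beta q\rfloor$ smallest entries and averages the others. **Assumptions.** (1) Each $F^j$ is $\lambda_F$-strongly convex and $L_F$-smooth on $\mathbb R^d$. (2) For $\mathcal D_j^*$-almost every $z$, $f(\cdot;z)$ is $L$-smooth and $\partial_hf(\cdot;z)$ is $L_h$-Lipschitz on $\mathbb R^d$; $L_f=(\sum_hL_h^2)^{1/2}$. (3) $\mathbb E_{\mathcal D_j^*}(f(\theta;z)-F^j(\theta))^2\le\eta^2$ for $\theta\in\Theta$. (4) For $\theta\in\Theta$, $X=\partial_hf(\theta;z)$ with $z\sim\mathcal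 D_j^*$ is $\sigma$-sub-exponential ($\sigma>0$): $\mathbb E e^{s(X-\mathbb EX)}\le e^{\sigma^2s^2/2}$ for all $|s|<1/\sigma$. (5) $\|\theta_j^*\|\le1$, $\|\theta_j^{(0)}-\theta_j^*\|\le\frac14\sqrt{\lambda_F/L_F}\,\Delta$, $n_{min}\ge C_0\frac{k\eta^2}{\lambda_F^2\Delta^4}$, $p\ge C_0\frac{\log N}{m}$ and $\Delta\ge C\log N\,\max\{n_{min}^{-1/5},m^{-1/6}n_{min}^{-1/3}\}$. **Theorem.** There is a universal constant $c_1>0$ such that for every $A>0$ there are $K,C_0>0$ depending only on $A$, and for all $d,\lambda_F,L_F,\sigma,\epsilon>0,D,(L_h)$ a $C>0$ depending only on these and $A$, such that the following holds. Assume (1)–(5), $\delta>0$, $b\le N^A$ and $$\frac{4c_1\eta^2}{p\,\delta\,\lambda_F^2\Delta^4n_{min}}+\frac{4\alpha}{p}\le\beta\le\frac12-\epsilon .$$ Put $\omega'=K\,\frac{\sigma d}{\epsilon}\Big(\frac{\beta}{\sqrt{n_{min}}}+\frac1{\sqrt{pmn_{min}}}\Big)\sqrt{\log(NL_fD)}$.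 Then with probability at least $$1-\delta-\frac1{N^A}-\frac{4d}{(1+\frac14pmn_{min}L_fD)^d},$$ for every $T\ge0$, every behaviour of the Byzantine machines and all $j\in[k]$, $$\|\theta_j^{(T)}-\theta_j^*\|\le\Big(1-\frac{\lambda_F}{\lambda_F+L_F}\Big)^T\|\theta_j^{(0)}-\theta_j^*\|+\frac2{\lambda_F}\,\omega'.$$ Moreover, on the same event, if $T\ge\frac{L_F+\lambda_F}{\lambda_F}\log\big(\frac{\lambda_F}{2\omega'}\max_j\|\theta_j^{(0)}-\theta_j^*\|\big)$, then $\|\theta_j^{(T)}-\theta_j^*\|\le4\omega'/\lambda_F$ for all $j$; and if in addition $\frac{4\alpha}p=c\beta$ with $c>0$, then for all $j$ $$\|\theta_j^{(T)}-\theta_j^*\|\le\frac{4K}{\lambda_F}\,\frac{\sigma}{\epsilon}\max\{1,\tfrac4c\}\Big(\frac{\alpha d}{p\sqrt{n_{min}}}+\frac d{\sqrt{pmn_{min}}}\Big)\sqrt{\log(NL_fD)},$$ that is, an error rate $\tilde{\mathcal O}\big(\frac{\alpha d}{p\sqrt{n_{min}}}+\frac d{\sqrt{pmn_{min}}}\big)$.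 -/

import Mathlib

open MeasureTheory ProbabilityTheory

noncomputable section

namespace ByzIFCA

/-- The parameter space is a subset of `ℝ^d` with the Euclidean norm. -/
abbrev Vec (d : ℕ) : Type := EuclideanSpace ℝ (Fin d)

/-- `F` is `a`-strongly convex: differentiable with
`F y ≥ F x + ⟨∇F x, y - x⟩ + (a / 2) ‖y - x‖²`. -/
def StronglyConvex {d : ℕ} (a : ℝ) (F : Vec d → ℝ) : Prop :=
  Differentiable ℝ F ∧
    ∀ x y : Vec d, F x + inner ℝ (gradient F x) (y - x) + a / 2 * ‖y - x‖ ^ 2 ≤ F y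

/-- `F` is `L`-smooth: differentiable with `L`-Lipschitz gradient. -/
def Smooth {d : ℕ} (L : ℝ) (F : Vec d → ℝ) : Prop :=
  Differentiable ℝ F ∧ ∀ x y : Vec d, ‖gradient F x - gradient F y‖ ≤ L * ‖x - y‖

/-- `X` is `v`-sub-exponential: it is integrable and, with `c = 𝔼 X`,
`𝔼 exp (s (X - c)) ≤ exp (v² s² / 2)` for all `|s| < 1 / v`. -/
def SubExponential {Z : Type*} [MeasurableSpace Z] (v : ℝ) (X : Z → ℝ) (P : Measure Z) : Prop :=
  Integrable X P ∧
    ∀ s : ℝ, |s| * v < 1 →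
      Integrable (fun z => Real.exp (s * (X z - ∫ y, X y ∂P))) P ∧
        ∫ z, Real.exp (s * (X z - ∫ y, X y ∂P)) ∂P ≤ Real.exp (v ^ 2 * s ^ 2 / 2)

/-- The `β`-trimmed mean of a finite multiset of `q` reals: sort it, remove the `⌊β q⌋` smallest
and the `⌊β q⌋` largest entries, and average the remaining ones. -/
def trimmedMean (β : ℝ) (s : Multiset ℝ) : ℝ :=
  (((s.sort (· ≤ ·)).drop ⌊β * (s.card : ℝ)⌋₊).take (s.card - 2 * ⌊β * (s.card : ℝ)⌋₊)).sum /
    ((s.card - 2 * ⌊β * (s.card : ℝ)⌋₊ : ℕ) : ℝ)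

/-- Coordinate-wise `β`-trimmed mean of the vectors `v i`, `i ∈ I`. -/
def trmean {d m : ℕ} (β : ℝ) (I : Finset (Fin m)) (v : Fin m → Vec d) : Vec d :=
  WithLp.toLp 2 (fun h => trimmedMean β (I.val.map (fun i => v i h)))

/-- `y` is the Euclidean projection of `x` onto `K`. -/
def IsProj {d : ℕ} (K : Set (Vec d)) (x y : Vec d) : Prop :=
  y ∈ K ∧ ∀ u ∈ K, ‖x - y‖ ≤ ‖x - u‖

/-- The data of a clustered federated learning problem with `m` machines, `k` clusters, parameter
dimension `d` and data points in `Z`. -/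
structure Setup (d k m : ℕ) (Z : Type*) [MeasurableSpace Z] where
  /-- parameter space -/
  Θ : Set (Vec d)
  /-- loss of a parameter at a data point -/
  f : Vec d → Z → ℝ
  /-- data distribution of each cluster -/
  dist : Fin k → Measure Z
  /-- the Byzantine machines -/
  byz : Finset (Fin m)
  /-- cluster of a machine (only used for normal machines) -/
  cl : Fin m → Fin k
  /-- number of data points of a machine (in one batch) -/
  n : Fin m → ℕ
  /-- the target parameters `θ_j^*` -/
  opt : Fin k → Vec d

namespace Setup

variable {d k m : ℕ} {Z : Type*} [MeasurableSpace Z] (S : Setup d k m Z)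

/-- The normal machines. -/
def normal : Finset (Fin m) := Finset.univ.filter (fun i => i ∉ S.byz)

/-- The true cluster `S_j^*`: the normal machines that draw from the `j`-th distribution. -/
def cluster (j : Fin k) : Finset (Fin m) := S.normal.filter (fun i => S.cl i = j)

/-- Population loss `F^j`. -/
def popLoss (j : Fin k) (θ : Vec d) : ℝ := ∫ z, S.f θ z ∂(S.dist j)

/-- Empirical loss of a sample `x` of size `q`. -/
def empLoss {q : ℕ} (x : Fin q → Z) (θ : Vec d) : ℝ := (1 / (q : ℝ)) * ∑ l, S.f θ (x l)

/-- The partial derivative `∂_h f(θ; z)`. -/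
def partialLoss (h : Fin d) (θ : Vec d) (z : Z) : ℝ := gradient (fun θ' => S.f θ' z) θ h

/-- Fraction of Byzantine machines. -/
def alpha : ℝ := (S.byz.card : ℝ) / (m : ℝ)

/-- Smallest cluster fraction `p = min_j |S_j^*| / m`. -/
def p : ℝ := ⨅ j : Fin k, ((S.cluster j).card : ℝ) / (m : ℝ)

/-- Smallest number of data points of a normal machine. -/
def nmin : ℕ := ⨅ i : {i : Fin m // i ∈ S.normal}, S.n i

/-- Total number of data points of the normal machines. -/
def N : ℕ := ∑ i ∈ S.normal, S.n i

/-- Minimal separation `Δ = min_{j ≠ j'} ‖θ_j^* - θ_{j'}^*‖`. -/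
def Δ : ℝ := ⨅ q : {q : Fin k × Fin k // q.1 ≠ q.2}, ‖S.opt q.1.1 - S.opt q.1.2‖

/-- Diameter of the parameter space. -/
def D : ℝ := Metric.diam S.Θ

/-- Standing conventions of the model. -/
structure Standing : Prop where
  two_le : 2 ≤ k
  convex : Convex ℝ S.Θ
  compact : IsCompact S.Θ
  prob : ∀ j, IsProbabilityMeasure (S.dist j)
  meas : ∀ θ, Measurable (S.f θ)
  integrable : ∀ j θ, Integrable (S.f θ) (S.dist j)
  cluster_nonempty : ∀ j, (S.cluster j).Nonempty
  n_pos : ∀ i ∈ S.normal, 0 < S.n i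
  opt_mem : ∀ j, S.opt j ∈ S.Θ
  opt_min : ∀ j, IsMinOn (S.popLoss j) S.Θ (S.opt j)
  /-- the minimizer over `Θ` is a stationary point of the population loss -/
  opt_stat : ∀ j, gradient (S.popLoss j) (S.opt j) = 0

/-- Every population loss is strongly convex and smooth. -/
def PopRegular (lamF LF : ℝ) : Prop :=
  ∀ j, StronglyConvex lamF (S.popLoss j) ∧ Smooth LF (S.popLoss j)

/-- For almost every data point, `f(·; z)` is `L`-smooth and its `h`-th partial derivative is
`Lh h`-Lipschitz. -/
def LossRegular (L : ℝ) (Lh : Fin d → ℝ) : Prop :=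
  ∀ j, ∀ᵐ z ∂(S.dist j), Smooth L (fun θ => S.f θ z) ∧
    ∀ h x y, |S.partialLoss h x z - S.partialLoss h y z| ≤ Lh h * ‖x - y‖

/-- The variance of the loss is at most `η²` on `Θ`. -/
def BoundedVariance (η : ℝ) : Prop :=
  ∀ j, ∀ θ ∈ S.Θ, Integrable (fun z => (S.f θ z - S.popLoss j θ) ^ 2) (S.dist j) ∧
    ∫ z, (S.f θ z - S.popLoss j θ) ^ 2 ∂(S.dist j) ≤ η ^ 2

/-- The partial derivatives of the loss are `σ`-sub-exponential on `Θ`. -/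
def SubExpGradient (σ : ℝ) : Prop :=
  ∀ j h, ∀ θ ∈ S.Θ, SubExponential σ (S.partialLoss h θ) (S.dist j)

/-- Normalization, initialization, sample size, cluster size and separation; `C₀` is the constant
in the two conditions on sample and cluster size, and `C` the one in the condition on the
separation. -/
structure Separated (C₀ C lamF LF η : ℝ) (init : Fin k → Vec d) : Prop where
  opt_norm : ∀ j, ‖S.opt j‖ ≤ 1
  init_mem : ∀ j, init j ∈ S.Θ
  init_close : ∀ j, ‖init j - S.opt j‖ ≤ 1 / 4 * √(lamF / LF) * S.Δ
  sample_size : C₀ * (k * η ^ 2 / (lamF ^ 2 * S.Δ ^ 4)) ≤ S.nmin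
  cluster_size : C₀ * (Real.log S.N / m) ≤ S.p
  separation : C * Real.log S.N *
    max ((S.nmin : ℝ) ^ (-(1 / 5 : ℝ))) ((m : ℝ) ^ (-(1 / 6 : ℝ)) * (S.nmin : ℝ) ^ (-(1 / 3 : ℝ)))
      ≤ S.Δ

/-- A sample for every machine. -/
abbrev Sample : Type _ := (i : Fin m) → Fin (S.n i) → Z

/-- The first `T` iterations of the algorithm with trimmed mean aggregation and step size `γ`,
started at `init`. In iteration `t` the normal machines estimate their cluster from the sample
`xc t` and compute the gradient from the sample `xg t`; `J t i` and `g t i` are the messages of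
machine `i`, on which nothing is required if `i` is Byzantine. -/
structure IsRun (β γ : ℝ) (init : Fin k → Vec d) (xc xg : ℕ → S.Sample) (T : ℕ)
    (θ : ℕ → Fin k → Vec d) (J : ℕ → Fin m → Fin k) (g : ℕ → Fin m → Vec d) : Prop where
  start : θ 0 = init
  estimate : ∀ t < T, ∀ i ∈ S.normal, ∀ j,
    S.empLoss (xc t i) (θ t (J t i)) ≤ S.empLoss (xc t i) (θ t j)
  grad : ∀ t < T, ∀ i ∈ S.normal, g t i = gradient (S.empLoss (xg t i)) (θ t (J t i))
  step : ∀ t < T, ∀ j,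
    IsProj S.Θ (θ t j - γ • trmean β (Finset.univ.filter (fun i => J t i = j)) (g t)) (θ (t + 1) j)

/-- The random data: `b` batches, all data points of normal machines independent, those of a
machine of cluster `j` with law `dist j`. -/
structure IsData {Ω : Type*} [MeasurableSpace Ω] (P : Measure Ω) {b : ℕ}
    (z : Fin b → (i : Fin m) → Fin (S.n i) → Ω → Z) : Prop where
  meas : ∀ r, ∀ i ∈ S.normal, ∀ l, Measurable (z r i l)
  law : ∀ r, ∀ i ∈ S.normal, ∀ l, P.map (z r i l) = S.dist (S.cl i)
  indep : iIndepFun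
    (fun q : Fin b × (Σ i : {i : Fin m // i ∈ S.normal}, Fin (S.n i)) =>
      z q.1 q.2.1 q.2.2) P

/-- The error term `K (σ d / ε) (β / √n_min + 1 / √(p m n_min)) √(log (N L_f D))`. -/
def err (K σ ε β Lf : ℝ) : ℝ :=
  K * (σ * d / ε * (β / √(S.nmin : ℝ) + 1 / √(S.p * m * S.nmin)) * √(Real.log (S.N * Lf * S.D)))

end Setup

end ByzIFCA

end

/-! ### Smooth and strongly convex functions, projections -/

namespace ByzIFCA

variable {d : ℕ}

/-! The probabilistic part is one uniform concentration event; on it the algorithm is analysed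
deterministically, against arbitrary Byzantine behaviour and with arbitrary reuse of batches.

The targets lie in the unit ball, so `Δ ≤ 2`, and the separation condition bounds `n_min` and `N`
below in terms of `C` (`Separated.mul_log_le_nmin`). Taking `C` large in the fixed parameters
absorbs all problem-dependent constants. A Chernoff bound at each point of a net of `Θ`, Lipschitz
continuity between net points and a union bound over batches, machines, clusters and coordinates
show that, off an event of probability at most `N^(-A)`, the empirical gradients of every normal
machine and their averages over every true cluster are close to the population gradients on all of
`Θ` (`IsData.measure_not_concentrated_le`). Uniformity in the parameter is what permits the iterates
to depend on the same data.

On this event no normal machine misjudges its cluster while the iterates stay within `(1/4)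
√(λ_F/L_F) Δ` of the targets: the population losses of a right and a wrong parameter then differ by
at least `λ_F Δ² / 4`, and integrating the gradient deviation over `Θ` gives less than that
(`Concentrated.estimate_eq`). The machines reporting `j` are thus all of `S_j^*` and some Byzantine
ones, the latter at most a fraction `β` of the group, and the trimmed mean tolerates these
(`Concentrated.norm_trmean_sub_le`).

Each iteration is therefore a gradient step on `F^j` with a perturbation of size at most `ω'`. The
exact step contracts by `1 - λ_F/(λ_F + L_F)`, the projection does not increase the distance to the
target, and the perturbation is too small to leave the basin, so the argument iterates
(`IsRun.norm_sub_opt_le`). -/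

lemma hasDerivAt_line {F : Vec d → ℝ} (hF : Differentiable ℝ F) (x v : Vec d) (s : ℝ) :
    HasDerivAt (fun s : ℝ => F (x + s • v)) (inner ℝ (gradient F (x + s • v)) v) s := by
  have h1 : HasDerivAt (fun s : ℝ => x + s • v) v s := by
    simpa using ((hasDerivAt_id s).smul_const v).const_add x
  have h2 := (hF (x + s • v)).hasFDerivAt.comp_hasDerivAt s h1
  rw [inner_gradient_left]
  exact h2

/-- Along the segment, `F` minus its linear part and the quadratic `L/2 s² ‖v‖²` is antitone: its
derivative is nonpositive by Cauchy–Schwarz and the Lipschitz bound on the gradient. -/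
lemma Smooth.upper {L : ℝ} {F : Vec d → ℝ} (hF : Smooth L F) (x y : Vec d) :
    F y ≤ F x + inner ℝ (gradient F x) (y - x) + L / 2 * ‖y - x‖ ^ 2 := by
  set v := y - x with hv
  let φ : ℝ → ℝ := fun s => F (x + s • v) - s * inner ℝ (gradient F x) v - L / 2 * s ^ 2 * ‖v‖ ^ 2
  have hφ : ∀ s, HasDerivAt φ (inner ℝ (gradient F (x + s • v)) v - inner ℝ (gradient F x) v
      - L * s * ‖v‖ ^ 2) s := by
    intro s
    have h1 := hasDerivAt_line hF.1 x v s
    have h2 : HasDerivAt (fun s : ℝ => s * inner ℝ (gradient F x) v)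
        (inner ℝ (gradient F x) v) s := by
      simpa using (hasDerivAt_id s).mul_const (inner ℝ (gradient F x) v)
    have h3 : HasDerivAt (fun s : ℝ => L / 2 * s ^ 2 * ‖v‖ ^ 2) (L * s * ‖v‖ ^ 2) s := by
      have := ((hasDerivAt_pow 2 s).const_mul (L / 2)).mul_const (‖v‖ ^ 2)
      refine this.congr_deriv ?_
      rw [Nat.cast_ofNat, show (2 : ℕ) - 1 = 1 from rfl]
      ring
    exact (h1.sub h2).sub h3
  have hanti : AntitoneOn φ (Set.Icc 0 1) := by
    apply antitoneOn_of_deriv_nonpos (convex_Icc 0 1)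
    · exact fun s _ => (hφ s).continuousAt.continuousWithinAt
    · exact fun s _ => (hφ s).differentiableAt.differentiableWithinAt
    · intro s hs
      rw [interior_Icc] at hs
      rw [(hφ s).deriv, ← inner_sub_left]
      have h4 := real_inner_le_norm (gradient F (x + s • v) - gradient F x) v
      have h5 := hF.2 (x + s • v) x
      rw [add_sub_cancel_left, norm_smul, Real.norm_of_nonneg hs.1.le] at h5
      nlinarith [norm_nonneg v]
  have h := hanti (Set.left_mem_Icc.2 zero_le_one) (Set.right_mem_Icc.2 zero_le_one) zero_le_one
  simp only [φ, one_smul, zero_smul, add_zero, hv, add_sub_cancel] at h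
  simp only [hv]
  linarith

lemma gradient_neg_fun {F : Vec d → ℝ} (x : Vec d) :
    gradient (fun y => -F y) x = -gradient F x := by
  unfold gradient
  rw [fderiv_fun_neg, map_neg]

lemma Smooth.neg {L : ℝ} {F : Vec d → ℝ} (hF : Smooth L F) : Smooth L (fun x => -F x) := by
  refine ⟨hF.1.neg, fun x y => ?_⟩
  rw [gradient_neg_fun, gradient_neg_fun, ← neg_sub', norm_neg]
  exact hF.2 x y

lemma Smooth.abs_sub_le {L : ℝ} {F : Vec d → ℝ} (hF : Smooth L F) (x y : Vec d) :
    |F y - F x - inner ℝ (gradient F x) (y - x)| ≤ L / 2 * ‖y - x‖ ^ 2 := by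
  have h1 := hF.upper x y
  have h2 := hF.neg.upper x y
  rw [gradient_neg_fun, inner_neg_left] at h2
  rw [abs_le]
  constructor <;> linarith

lemma StronglyConvex.inner_le {a : ℝ} {F : Vec d → ℝ} (hF : StronglyConvex a F) (x y : Vec d) :
    a * ‖x - y‖ ^ 2 ≤ inner ℝ (gradient F x - gradient F y) (x - y) := by
  have h1 := hF.2 x y
  have h2 := hF.2 y x
  rw [← neg_sub x y, inner_neg_right, norm_neg] at h1
  rw [inner_sub_left]
  linarith

/-- Two distinct points are needed: in dimension zero both hypotheses hold for all `a` and `L`. -/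
lemma StronglyConvex.le_of_smooth {a L : ℝ} {F : Vec d → ℝ} (hF : StronglyConvex a F)
    (hL : Smooth L F) {x y : Vec d} (hxy : x ≠ y) : a ≤ L := by
  have h1 := hF.inner_le x y
  have h2 := real_inner_le_norm (gradient F x - gradient F y) (x - y)
  have h3 := hL.2 x y
  have h4 : 0 < ‖x - y‖ := norm_pos_iff.2 (sub_ne_zero.2 hxy)
  have h5 : a * ‖x - y‖ ^ 2 ≤ L * ‖x - y‖ ^ 2 := by nlinarith
  exact le_of_mul_le_mul_right h5 (by positivity)

/-- Co-coercivity of the gradient of a strongly convex and smooth function. -/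
lemma StronglyConvex.cocoercive {a L : ℝ} {F : Vec d → ℝ} (hF : StronglyConvex a F)
    (hL : Smooth L F) (haL : a ≤ L) (x y : Vec d) :
    ‖gradient F x - gradient F y‖ ^ 2 + a * L * ‖x - y‖ ^ 2 ≤
      (L + a) * inner ℝ (gradient F x - gradient F y) (x - y) := by
  set e := x - y with he
  set u := gradient F x - gradient F y with hu
  -- This is the gradient difference of `F - a/2 ‖·‖²`, which is convex and, morally, `(L -
  -- a)`-smooth; the claim is the co-coercivity of that function, rewritten.
  set v := u - a • e with hv
  -- At the trial points `x - τ v` and `y + τ v`, strong convexity bounds `F` below from the far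
  -- base point and smoothness bounds it above from the near one. Adding the four inequalities
  -- cancels all values of `F`.
  have key : ∀ τ : ℝ, 2 * τ * ‖v‖ ^ 2 - (L - a) * τ ^ 2 * ‖v‖ ^ 2 ≤ inner ℝ v e := by
    intro τ
    have h1 := hF.2 y (x - τ • v)
    have h2 := hL.upper x (x - τ • v)
    have h3 := hF.2 x (y + τ • v)
    have h4 := hL.upper y (y + τ • v)
    have e1 : x - τ • v - y = e - τ • v := by rw [he]; abel
    have e2 : x - τ • v - x = -(τ • v) := by abel
    have e3 : y + τ • v - x = -(e - τ • v) := by rw [he]; abel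
    have e4 : y + τ • v - y = τ • v := by abel
    rw [e1] at h1
    rw [e2, norm_neg, inner_neg_right] at h2
    rw [e3, norm_neg, inner_neg_right] at h3
    rw [e4] at h4
    have h5 : ‖e - τ • v‖ ^ 2 = ‖e‖ ^ 2 - 2 * (τ * inner ℝ v e) + τ ^ 2 * ‖v‖ ^ 2 := by
      rw [norm_sub_sq_real, inner_smul_right, norm_smul, mul_pow, Real.norm_eq_abs, sq_abs,
        real_inner_comm]
    have h6 : ‖τ • v‖ ^ 2 = τ ^ 2 * ‖v‖ ^ 2 := by
      rw [norm_smul, mul_pow, Real.norm_eq_abs, sq_abs]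
    have h7 : inner ℝ v e = inner ℝ u e - a * ‖e‖ ^ 2 := by
      rw [hv, inner_sub_left, inner_smul_left, real_inner_self_eq_norm_sq]; simp
    have h8 : inner ℝ u v = ‖v‖ ^ 2 + a * inner ℝ v e := by
      have : u = v + a • e := by rw [hv]; abel
      rw [this, inner_add_left, inner_smul_left, real_inner_self_eq_norm_sq, real_inner_comm]; simp
    have h9 : inner ℝ (gradient F x) e - inner ℝ (gradient F y) e = inner ℝ u e := by
      rw [hu, inner_sub_left]
    have h10 : inner ℝ (gradient F x) v - inner ℝ (gradient F y) v = inner ℝ u v := by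
      rw [hu, inner_sub_left]
    rw [inner_sub_right, inner_smul_right, h5] at h1
    rw [inner_smul_right, h6] at h2
    rw [inner_sub_right, inner_smul_right, h5] at h3
    rw [inner_smul_right, h6] at h4
    have h11 : τ * inner ℝ (gradient F x) v - τ * inner ℝ (gradient F y) v
        = τ * (‖v‖ ^ 2 + a * inner ℝ v e) := by rw [← mul_sub, h10, h8]
    linarith
  -- The optimal `τ` is `1 / (L - a)`. If `a = L`, `key` is linear in `τ`, and letting `τ` be large
  -- forces `v = 0`.
  have hfin : ‖v‖ ^ 2 ≤ (L - a) * inner ℝ v e := by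
    rcases haL.eq_or_lt with h | h
    · have hz : ‖v‖ ^ 2 ≤ 0 := by
        by_contra hpos
        push Not at hpos
        have := key ((inner ℝ v e + 1) / (2 * ‖v‖ ^ 2))
        rw [h] at this
        have h2 : 2 * ((inner ℝ v e + 1) / (2 * ‖v‖ ^ 2)) * ‖v‖ ^ 2 = inner ℝ v e + 1 := by
          rw [mul_div_assoc', mul_div_mul_left _ _ two_ne_zero, div_mul_cancel₀ _ hpos.ne']
        linarith
      rw [h, sub_self, zero_mul]
      exact hz
    · have h0 : 0 < L - a := by linarith
      have := key (1 / (L - a))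
      have h2 : 2 * (1 / (L - a)) * ‖v‖ ^ 2 - (L - a) * (1 / (L - a)) ^ 2 * ‖v‖ ^ 2
          = ‖v‖ ^ 2 / (L - a) := by
        field_simp
        ring
      rw [h2, div_le_iff₀ h0] at this
      linarith
  have h7 : inner ℝ v e = inner ℝ u e - a * ‖e‖ ^ 2 := by
    rw [hv, inner_sub_left, inner_smul_left, real_inner_self_eq_norm_sq]; simp
  have h8 : ‖v‖ ^ 2 = ‖u‖ ^ 2 - 2 * (a * inner ℝ u e) + a ^ 2 * ‖e‖ ^ 2 := by
    rw [hv, norm_sub_sq_real, inner_smul_right, norm_smul, mul_pow, Real.norm_eq_abs, sq_abs]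
  nlinarith

/-- A gradient step with step size `1 / L` is a contraction towards a stationary point. -/
lemma StronglyConvex.gradient_step {a L : ℝ} {F : Vec d → ℝ} (hF : StronglyConvex a F)
    (hL : Smooth L F) (ha : 0 < a) (haL : a ≤ L) {u : Vec d} (hu : gradient F u = 0) (x : Vec d) :
    ‖x - (1 / L) • gradient F x - u‖ ≤ (1 - a / (a + L)) * ‖x - u‖ := by
  have hL0 : 0 < L := ha.trans_le haL
  have h1 := hF.cocoercive hL haL x u
  rw [hu, sub_zero] at h1
  have hρ : 1 - a / (a + L) = L / (a + L) := by field_simp; ring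
  rw [hρ]
  refine abs_le_of_sq_le_sq' ?_ (by positivity) |>.2
  have e1 : x - (1 / L) • gradient F x - u = (x - u) - (1 / L) • gradient F x := by abel
  rw [e1, norm_sub_sq_real, inner_smul_right, norm_smul, mul_pow, Real.norm_eq_abs, sq_abs,
    real_inner_comm]
  set I := inner ℝ (gradient F x) (x - u)
  set g2 := ‖gradient F x‖ ^ 2
  set r2 := ‖x - u‖ ^ 2 with hr2
  have hr0 : 0 ≤ r2 := by positivity
  have hg0 : 0 ≤ g2 := by positivity
  have hI : (g2 + a * L * r2) / (L + a) ≤ I := by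
    rw [div_le_iff₀ (by positivity)]; linarith
  have h2 : r2 - 2 * (1 / L * I) + (1 / L) ^ 2 * g2 ≤
      r2 - 2 * (1 / L * ((g2 + a * L * r2) / (L + a))) + (1 / L) ^ 2 * g2 := by
    have : 0 < 1 / L := by positivity
    nlinarith
  refine h2.trans ?_
  -- Once the inner product is replaced by its co-coercive lower bound, the slack is an explicit sum
  -- of two terms, nonnegative because `a ≤ L`.
  have h3 : (L / (a + L)  * ‖x - u‖) ^ 2
      - (r2 - 2 * (1 / L * ((g2 + a * L * r2) / (L + a))) + (1 / L) ^ 2 * g2)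
      = (a / (a + L)) ^ 2 * r2 + (L - a) / (L ^ 2 * (L + a)) * g2 := by
    rw [mul_pow, ← hr2]
    field_simp
    ring
  have h4 : 0 ≤ (L - a) / (L ^ 2 * (L + a)) := by
    have : 0 ≤ L - a := by linarith
    positivity
  nlinarith [mul_nonneg h4 hg0, mul_nonneg (sq_nonneg (a / (a + L))) hr0]

/-- The angle at `y` between `x` and `u` is obtuse, by the variational characterization of the
projection. -/
lemma IsProj.norm_sub_le {K : Set (Vec d)} (hK : Convex ℝ K) {x y u : Vec d} (h : IsProj K x y)
    (hu : u ∈ K) : ‖y - u‖ ≤ ‖x - u‖ := by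
  have : Nonempty K := ⟨⟨u, hu⟩⟩
  have h1 : ‖x - y‖ = ⨅ w : K, ‖x - w‖ := by
    apply le_antisymm
    · exact le_ciInf fun w => h.2 w w.2
    · exact ciInf_le ⟨0, by rintro _ ⟨w, rfl⟩; exact norm_nonneg _⟩ (⟨y, h.1⟩ : K)
  have h2 := (norm_eq_iInf_iff_real_inner_le_zero hK h.1).1 h1 u hu
  refine abs_le_of_sq_le_sq' ?_ (by positivity) |>.2
  have e : x - u = (x - y) - (u - y) := by abel
  rw [e, norm_sub_sq_real (x - y), ← norm_neg (y - u), neg_sub]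
  nlinarith [sq_nonneg ‖x - y‖]

lemma abs_sub_le_of_gradient_le {F : Vec d → ℝ} (hF : Differentiable ℝ F) {K : Set (Vec d)}
    (hK : Convex ℝ K) {B : ℝ} (hB : ∀ x ∈ K, ‖gradient F x‖ ≤ B) {x y : Vec d} (hx : x ∈ K)
    (hy : y ∈ K) : |F y - F x| ≤ B * ‖y - x‖ := by
  refine hK.norm_image_sub_le_of_norm_fderiv_le (𝕜 := ℝ) (fun z _ => hF z) (fun z hz => ?_) hx hy
  rw [← toDual_gradient, LinearIsometryEquiv.norm_map]
  exact hB z hz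

lemma norm_le_sqrt_mul {v : Vec d} {a : ℝ} (ha : 0 ≤ a) (h : ∀ i, |v i| ≤ a) :
    ‖v‖ ≤ √d * a := by
  rw [EuclideanSpace.norm_eq]
  apply Real.sqrt_le_iff.2 ⟨by positivity, ?_⟩
  rw [mul_pow, Real.sq_sqrt (by positivity)]
  calc ∑ i, ‖v i‖ ^ 2 ≤ ∑ _i : Fin d, a ^ 2 :=
        Finset.sum_le_sum fun i _ => pow_le_pow_left₀ (norm_nonneg _) (h i) 2
    _ = d * a ^ 2 := by simp

end ByzIFCA

/-! ### Trimmed means -/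

namespace ByzIFCA

/-- Clipping to `[-M, M]`. -/
def clip (M x : ℝ) : ℝ := max (-M) (min M x)

lemma abs_clip_le {M : ℝ} (hM : 0 ≤ M) (x : ℝ) : |clip M x| ≤ M := by
  unfold clip
  rw [abs_le]
  exact ⟨le_max_left _ _, max_le (by linarith) (min_le_left _ _)⟩

lemma clip_eq_self {M x : ℝ} (h : |x| ≤ M) : clip M x = x := by
  unfold clip
  rw [abs_le] at h
  rw [min_eq_right h.2, max_eq_right h.1]

lemma abs_multiset_sum_map_le {α : Type*} (s : Multiset α) (c : α → ℝ) {M : ℝ}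
    (h : ∀ x ∈ s, |c x| ≤ M) : |(s.map c).sum| ≤ s.card * M := by
  induction s using Multiset.induction_on with
  | empty => simp
  | cons a s ih =>
    simp only [Multiset.map_cons, Multiset.sum_cons, Multiset.card_cons]
    have h1 := h a (Multiset.mem_cons_self a s)
    have h2 := ih fun x hx => h x (Multiset.mem_cons_of_mem hx)
    push_cast
    calc |c a + (s.map c).sum| ≤ |c a| + |(s.map c).sum| := abs_add_le _ _
      _ ≤ (s.card + 1) * M := by linarith

/-- If all but `r` of the entries of `s` are within `M` of `μ` and at least `r` entries are
trimmed on each side, then the trimmed mean is close to `μ`. -/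
lemma abs_trimmedMean_sub_le {β μ M : ℝ} (s G B : Multiset ℝ) (hs : s = G + B) (hM : 0 ≤ M)
    (hG : ∀ x ∈ G, |x - μ| ≤ M) (hB : B.card ≤ ⌊β * (s.card : ℝ)⌋₊)
    (hlt : 2 * ⌊β * (s.card : ℝ)⌋₊ < s.card) :
    |trimmedMean β s - μ| ≤
      (|(G.map (fun x => x - μ)).sum| + 3 * ⌊β * (s.card : ℝ)⌋₊ * M)
        / ((s.card : ℝ) - 2 * ⌊β * (s.card : ℝ)⌋₊) := by
  unfold trimmedMean
  set r := ⌊β * (s.card : ℝ)⌋₊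
  set l := s.sort (· ≤ ·) with hl
  have hls : (l : Multiset ℝ) = s := Multiset.sort_eq s _
  have hlen : l.length = s.card := by simp [hl]
  set low := l.take r with hlow
  set kept := (l.drop r).take (s.card - 2 * r) with hkept
  set high := (l.drop r).drop (s.card - 2 * r) with hhigh
  have hsplit : l = low ++ (kept ++ high) := by
    rw [hkept, hhigh, List.take_append_drop, hlow, List.take_append_drop]
  have hlowc : low.length = r := by
    rw [hlow, List.length_take, hlen]; omega
  have hkeptc : kept.length = s.card - 2 * r := by
    rw [hkept, List.length_take, List.length_drop, hlen]; omega
  have hhighc : high.length = r := by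
    rw [hhigh, List.length_drop, List.length_drop, hlen]; omega
  have hpw : l.Pairwise (· ≤ ·) := Multiset.pairwise_sort s _
  rw [hsplit, List.pairwise_append, List.pairwise_append] at hpw
  obtain ⟨-, ⟨-, -, hkh⟩, hlk⟩ := hpw
  have hcount : ∀ (q : ℝ → Prop) [DecidablePred q], (∀ x ∈ G, ¬ q x) →
      low.countP q + (kept.countP q + high.countP q) ≤ r := by
    intro q _ hq
    rw [← List.countP_append, ← List.countP_append, ← hsplit, ← Multiset.coe_countP, hls, hs,
      Multiset.countP_add, Multiset.countP_eq_zero.2 hq, zero_add]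
    exact (Multiset.countP_le_card _ _).trans hB
  -- By sortedness, a kept entry beyond `M` on one side would make all `r` entries trimmed on that
  -- side bad as well, giving more than the `r` bad entries that `hcount` allows.
  have hkM : ∀ x ∈ kept, |x - μ| ≤ M := by
    intro x hx
    rw [abs_le]
    constructor
    · by_contra hcon
      push Not at hcon
      have h1 := hcount (fun y => y - μ < -M) fun y hy => not_lt.2 (abs_le.1 (hG y hy)).1
      have h2 : low.countP (fun y => y - μ < -M) = low.length := by
        rw [List.countP_eq_length]
        intro y hy
        have := hlk y hy x (List.mem_append_left _ hx)
        simp only [decide_eq_true_eq]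
        linarith
      have h3 : 0 < kept.countP (fun y => y - μ < -M) :=
        List.countP_pos_iff.2 ⟨x, hx, by simpa using hcon⟩
      omega
    · by_contra hcon
      push Not at hcon
      have h1 := hcount (fun y => M < y - μ) fun y hy => not_lt.2 (abs_le.1 (hG y hy)).2
      have h2 : high.countP (fun y => M < y - μ) = high.length := by
        rw [List.countP_eq_length]
        intro y hy
        have := hkh x hx y hy
        simp only [decide_eq_true_eq]
        linarith
      have h3 : 0 < kept.countP (fun y => M < y - μ) :=
        List.countP_pos_iff.2 ⟨x, hx, by simpa using hcon⟩
      omega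
  have hpos : (0 : ℝ) < (s.card : ℝ) - 2 * r := by
    have : ((2 * r : ℕ) : ℝ) < s.card := by exact_mod_cast hlt
    push_cast at this
    linarith
  have hcast : ((s.card - 2 * r : ℕ) : ℝ) = (s.card : ℝ) - 2 * r := by
    rw [Nat.cast_sub hlt.le]; push_cast; ring
  rw [hcast]
  -- The sum of the clipped deviations over `s` is computed twice, as `G + B` and as `low + kept +
  -- high`. Clipping is the identity on `G` and `kept`, while `B`, `low` and `high` contribute at
  -- most `r M` each, whatever the adversarial values: hence the constant 3.
  let c : ℝ → ℝ := fun x => clip M (x - μ)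
  have hc : ∀ x, |c x| ≤ M := fun x => abs_clip_le hM _
  have hsum : (s.map c).sum = (G.map c).sum + (B.map c).sum := by
    rw [hs, Multiset.map_add, Multiset.sum_add]
  have hsum2 : (s.map c).sum = (low.map c).sum + ((kept.map c).sum + (high.map c).sum) := by
    rw [← hls, Multiset.map_coe, Multiset.sum_coe, hsplit, List.map_append, List.map_append,
      List.sum_append, List.sum_append]
  have hGc : (G.map c).sum = (G.map (fun x => x - μ)).sum := by
    congr 1
    exact Multiset.map_congr rfl fun x hx => clip_eq_self (hG x hx)
  have hkc : (kept.map c).sum = kept.sum - kept.length * μ := by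
    have h1 : kept.map c = kept.map (fun x => x - μ) :=
      List.map_congr_left fun x hx => clip_eq_self (hkM x hx)
    rw [h1]
    clear_value kept
    clear h1 hkM hkeptc hsplit hkh hlk hcount hsum2 hkept
    induction kept with
    | nil => simp
    | cons a t ih =>
      simp only [List.map_cons, List.sum_cons, ih, List.length_cons]
      push_cast
      ring
  have hBb : |(B.map c).sum| ≤ r * M :=
    (abs_multiset_sum_map_le B c fun x _ => hc x).trans
      (mul_le_mul_of_nonneg_right (by exact_mod_cast hB) hM)
  have hlowb : |(low.map c).sum| ≤ r * M := by
    have := abs_multiset_sum_map_le (low : Multiset ℝ) c fun x _ => hc x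
    rwa [Multiset.map_coe, Multiset.sum_coe, Multiset.coe_card, hlowc] at this
  have hhighb : |(high.map c).sum| ≤ r * M := by
    have := abs_multiset_sum_map_le (high : Multiset ℝ) c fun x _ => hc x
    rwa [Multiset.map_coe, Multiset.sum_coe, Multiset.coe_card, hhighc] at this
  have hdiff : kept.sum / ((s.card : ℝ) - 2 * r) - μ
      = (kept.map c).sum / ((s.card : ℝ) - 2 * r) := by
    rw [hkc, hkeptc, hcast]
    field_simp
  rw [hdiff, abs_div, abs_of_pos hpos]
  apply div_le_div_of_nonneg_right _ hpos.le
  have heq : (kept.map c).sum = (G.map (fun x => x - μ)).sum + (B.map c).sum - (low.map c).sum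
      - (high.map c).sum := by
    rw [← hGc]; linarith
  rw [heq]
  have a1 := abs_sub ((G.map (fun x => x - μ)).sum + (B.map c).sum - (low.map c).sum)
    ((high.map c).sum)
  have a2 := abs_sub ((G.map (fun x => x - μ)).sum + (B.map c).sum) ((low.map c).sum)
  have a3 := abs_add_le ((G.map (fun x => x - μ)).sum) ((B.map c).sum)
  linarith

/-- The trimmed mean of finitely many reals, of which those with index in `G` are close to `μ`. -/
lemma abs_trimmedMean_map_sub_le {m : ℕ} {β ε μ M a : ℝ} (I G : Finset (Fin m)) (hGI : G ⊆ I)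
    (v : Fin m → ℝ) (hM : 0 ≤ M) (hε : 0 < ε) (hβ0 : 0 ≤ β) (hβ : β ≤ 1 / 2 - ε)
    (hGne : G.Nonempty)
    (hG : ∀ i ∈ G, |v i - μ| ≤ M) (hsum : |∑ i ∈ G, (v i - μ)| ≤ G.card * a)
    (hB : ((I \ G).card : ℝ) ≤ β * I.card) :
    |trimmedMean β (I.val.map v) - μ| ≤ (a + 3 * β * M) / (2 * ε) := by
  have hGc : 0 < G.card := hGne.card_pos
  have hIc : 0 < I.card := hGc.trans_le (Finset.card_le_card hGI)
  have hIc' : (0 : ℝ) < I.card := by exact_mod_cast hIc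
  have ha : 0 ≤ a := by
    have h0 := (abs_nonneg _).trans hsum
    have h1 : (0 : ℝ) < G.card := by exact_mod_cast hGc
    exact nonneg_of_mul_nonneg_right h0 h1
  have hcard : (I.val.map v).card = I.card := by simp
  have hsplit : I.val.map v = G.val.map v + (I \ G).val.map v := by
    rw [← Multiset.map_add, Finset.sdiff_val, add_tsub_cancel_of_le (Finset.val_le_iff.2 hGI)]
  have hr : (⌊β * (I.card : ℝ)⌋₊ : ℝ) ≤ β * I.card := Nat.floor_le (by positivity)
  have hlt : 2 * ⌊β * (I.card : ℝ)⌋₊ < I.card := by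
    have : (2 : ℝ) * ⌊β * (I.card : ℝ)⌋₊ < I.card := by nlinarith
    exact_mod_cast this
  have h := abs_trimmedMean_sub_le (β := β) (μ := μ) (M := M) _ _ _ hsplit hM
    (by intro x hx
        obtain ⟨i, hi, rfl⟩ := Multiset.mem_map.1 hx
        exact hG i hi)
    (by rw [hcard, Multiset.card_map]; exact Nat.le_floor hB) (by rw [hcard]; exact hlt)
  rw [hcard, Multiset.map_map] at h
  refine h.trans ?_
  have hden : 2 * ε * I.card ≤ (I.card : ℝ) - 2 * ⌊β * (I.card : ℝ)⌋₊ := by nlinarith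
  have hGI' : (G.card : ℝ) ≤ I.card := by exact_mod_cast Finset.card_le_card hGI
  have hnum : |(Multiset.map ((fun x => x - μ) ∘ v) G.val).sum|
      + 3 * ⌊β * (I.card : ℝ)⌋₊ * M ≤ I.card * (a + 3 * β * M) := by
    have h1 : |(Multiset.map ((fun x => x - μ) ∘ v) G.val).sum| ≤ G.card * a := hsum
    have h2 : G.card * a ≤ I.card * a := by gcongr
    have h3 : 3 * ⌊β * (I.card : ℝ)⌋₊ * M ≤ 3 * (β * I.card) * M := by gcongr
    linarith
  calc _ ≤ (I.card * (a + 3 * β * M)) / (2 * ε * I.card) := by gcongr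
    _ = (a + 3 * β * M) / (2 * ε) := by field_simp

end ByzIFCA

/-! ### Gradients of population and empirical losses -/

namespace ByzIFCA

variable {d k m : ℕ} {Z : Type*} [MeasurableSpace Z] {S : Setup d k m Z}

namespace Setup

/-- Differentiation under the integral sign for the population loss. -/
lemma gradient_popLoss_apply (hS : S.Standing) {L : ℝ} {Lh : Fin d → ℝ} (hL : S.LossRegular L Lh)
    (j : Fin k) {θ : Vec d} (hi : ∀ h, Integrable (S.partialLoss h θ) (S.dist j)) (h : Fin d) :
    gradient (S.popLoss j) θ h = ∫ z, S.partialLoss h θ z ∂(S.dist j) := by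
  have := hS.prob j
  set v : Vec d := WithLp.toLp 2 (fun h => ∫ z, S.partialLoss h θ z ∂(S.dist j)) with hv
  suffices hg : HasGradientAt (S.popLoss j) v θ by rw [hg.gradient]
  -- Integrating the second-order remainder bound makes the remainder quadratic in `y - θ`, which
  -- gives differentiability without dominating difference quotients.
  have hbound : ∀ y, |S.popLoss j y - S.popLoss j θ - inner ℝ v (y - θ)|
      ≤ L / 2 * ‖y - θ‖ ^ 2 := by
    intro y
    have h1 : S.popLoss j y - S.popLoss j θ - inner ℝ v (y - θ)
        = ∫ z, (S.f y z - S.f θ z - ∑ h, (y - θ) h * S.partialLoss h θ z) ∂(S.dist j) := by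
      rw [integral_sub (f := fun z => S.f y z - S.f θ z)
        ((hS.integrable j y).sub (hS.integrable j θ)) (integrable_finsetSum _ fun h _ => (hi h).const_mul _),
        integral_sub (hS.integrable j y) (hS.integrable j θ),
        integral_finsetSum _ fun h _ => (hi h).const_mul _]
      simp only [integral_const_mul, PiLp.inner_apply, RCLike.inner_apply, conj_trivial, hv, popLoss]
    rw [h1, ← Real.norm_eq_abs]
    refine (norm_integral_le_of_norm_le_const (C := L / 2 * ‖y - θ‖ ^ 2) ?_).trans ?_
    · filter_upwards [hL j] with z hz
      have h2 := hz.1.abs_sub_le θ y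
      simp only [PiLp.inner_apply, RCLike.inner_apply, conj_trivial] at h2
      exact h2
    · simp
  rw [hasGradientAt_iff_isLittleO]
  refine Asymptotics.IsBigO.trans_isLittleO (g := fun y => ‖y - θ‖ ^ 2) ?_
    (Asymptotics.isLittleO_pow_sub_sub θ one_lt_two)
  refine Asymptotics.IsBigO.of_bound (L / 2) (Filter.Eventually.of_forall fun y => ?_)
  rw [Real.norm_eq_abs, Real.norm_of_nonneg (by positivity)]
  exact hbound y

/-- The partial derivatives of the population loss inherit the Lipschitz constants. -/
lemma abs_gradient_popLoss_sub_le (hS : S.Standing) {L : ℝ} {Lh : Fin d → ℝ}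
    (hL : S.LossRegular L Lh) (j : Fin k) {θ u : Vec d}
    (hθ : ∀ h, Integrable (S.partialLoss h θ) (S.dist j))
    (hu : ∀ h, Integrable (S.partialLoss h u) (S.dist j)) (h : Fin d) :
    |gradient (S.popLoss j) θ h - gradient (S.popLoss j) u h| ≤ Lh h * ‖θ - u‖ := by
  have := hS.prob j
  rw [gradient_popLoss_apply hS hL j hθ, gradient_popLoss_apply hS hL j hu,
    ← integral_sub (hθ h) (hu h), ← Real.norm_eq_abs]
  refine (norm_integral_le_of_norm_le_const (C := Lh h * ‖θ - u‖) ?_).trans (by simp)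
  filter_upwards [hL j] with z hz using hz.2 h θ u

/-- The gradient of the empirical loss is the average of the gradients of the losses. -/
lemma gradient_empLoss_apply {q : ℕ} (x : Fin q → Z) (θ : Vec d)
    (hx : ∀ l, DifferentiableAt ℝ (fun θ' => S.f θ' (x l)) θ) (h : Fin d) :
    gradient (S.empLoss x) θ h = 1 / (q : ℝ) * ∑ l, S.partialLoss h θ (x l) := by
  have h1 : gradient (S.empLoss x) θ
      = (1 / (q : ℝ)) • ∑ l, gradient (fun θ' => S.f θ' (x l)) θ := by
    unfold gradient
    have : fderiv ℝ (S.empLoss x) θ = (1 / (q : ℝ)) • ∑ l, fderiv ℝ (fun θ' => S.f θ' (x l)) θ := by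
      unfold Setup.empLoss
      rw [fderiv_const_mul (DifferentiableAt.fun_sum fun l _ => hx l),
        fderiv_fun_sum fun l _ => hx l]
    rw [this, map_smul, map_sum]
  rw [h1]
  simp [Setup.partialLoss]

lemma differentiable_empLoss {q : ℕ} (x : Fin q → Z)
    (hx : ∀ l, Differentiable ℝ (fun θ' => S.f θ' (x l))) : Differentiable ℝ (S.empLoss x) := by
  unfold Setup.empLoss
  exact (Differentiable.fun_sum fun l _ => hx l).const_mul _

end Setup

end ByzIFCA

/-! ### Chernoff bound for weighted sums -/

namespace ByzIFCA

/-- Chernoff bound for a weighted sum of independent centred sub-exponential variables. -/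
lemma measureReal_weighted_sum_ge_le {Ω ι : Type*} [MeasurableSpace Ω] [Fintype ι] {P : Measure Ω}
    [IsProbabilityMeasure P] {X : ι → Ω → ℝ} (hind : iIndepFun X P) (hX : ∀ i, Measurable (X i))
    {σ V t : ℝ} (hσ : 0 < σ) (hV : 0 < V) (ht : 0 ≤ t) (htV : 2 * t * V < 1)
    (hmgf : ∀ i s, |s| * σ < 1 → Integrable (fun ω => Real.exp (s * X i ω)) P ∧
      ∫ ω, Real.exp (s * X i ω) ∂P ≤ Real.exp (σ ^ 2 * s ^ 2 / 2))
    (w : ι → ℝ) (hw : ∀ i, |w i| ≤ V) (hw2 : ∑ i, w i ^ 2 ≤ V) :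
    P.real {ω | σ * √(2 * t * V) ≤ ∑ i, w i * X i ω} ≤ Real.exp (-t) := by
  -- The minimizer of the Chernoff exponent `σ² s² V / 2 - s σ √(2 t V)`. The condition `2 t V < 1`
  -- keeps each `s * w i` in the range where the sub-exponential bound is available.
  set s := √(2 * t / V) / σ with hs
  have hs0 : 0 ≤ s := by positivity
  have hsV : s * σ * V = √(2 * t * V) := by
    rw [hs, div_mul_cancel₀ _ hσ.ne']
    nth_rewrite 2 [← Real.sqrt_sq hV.le]
    rw [← Real.sqrt_mul (by positivity)]
    congr 1
    field_simp
  have hlt : ∀ i, |s * w i| * σ < 1 := by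
    intro i
    rw [abs_mul, abs_of_nonneg hs0]
    calc s * |w i| * σ ≤ s * V * σ := by gcongr; exact hw i
      _ = √(2 * t * V) := by rw [← hsV]; ring
      _ < 1 := by rw [Real.sqrt_lt' one_pos]; linarith
  set Y : ι → Ω → ℝ := fun i ω => w i * X i ω with hY
  have hYind : iIndepFun Y P := hind.comp (fun i x => w i * x) fun i => measurable_const_mul _
  have hYm : ∀ i, Measurable (Y i) := fun i => (hX i).const_mul _
  have hYe : ∀ i ω, s * Y i ω = s * w i * X i ω := fun i ω => by simp only [hY]; ring
  have hYint : ∀ i ∈ Finset.univ, Integrable (fun ω => Real.exp (s * Y i ω)) P := by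
    intro i _
    simp only [hYe]
    exact (hmgf i _ (hlt i)).1
  have hset : {ω | σ * √(2 * t * V) ≤ ∑ i, w i * X i ω}
      = {ω | σ * √(2 * t * V) ≤ (∑ i, Y i) ω} := by
    ext ω; simp [hY]
  rw [hset]
  refine (measure_ge_le_exp_mul_mgf _ hs0 (hYind.integrable_exp_mul_sum hYm hYint)).trans ?_
  rw [hYind.mgf_sum hYm]
  have hprod : ∏ i, mgf (Y i) P s ≤ ∏ i, Real.exp (σ ^ 2 * (s * w i) ^ 2 / 2) := by
    refine Finset.prod_le_prod (fun i _ => mgf_nonneg) fun i _ => ?_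
    unfold mgf
    simp only [hYe]
    exact (hmgf i _ (hlt i)).2
  refine (mul_le_mul_of_nonneg_left hprod (Real.exp_pos _).le).trans ?_
  rw [← Real.exp_sum, ← Real.exp_add, Real.exp_le_exp]
  have h1 : ∑ i, σ ^ 2 * (s * w i) ^ 2 / 2 = (s * σ) ^ 2 / 2 * ∑ i, w i ^ 2 := by
    rw [Finset.mul_sum]
    exact Finset.sum_congr rfl fun i _ => by ring
  have h2 : (s * σ) ^ 2 = 2 * t / V := by
    rw [hs, div_mul_cancel₀ _ hσ.ne', Real.sq_sqrt (by positivity)]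
  have h3 : s * (σ * √(2 * t * V)) = 2 * t := by
    rw [← hsV, show s * (σ * (s * σ * V)) = (s * σ) ^ 2 * V by ring, h2]
    field_simp
  have h4 : 2 * t / V / 2 * ∑ i, w i ^ 2 ≤ 2 * t / V / 2 * V := by gcongr
  have h5 : 2 * t / V / 2 * V = t := by field_simp
  rw [h1, h2, neg_mul, h3]
  linarith

lemma measure_lt_abs_weighted_sum_le {Ω ι : Type*} [MeasurableSpace Ω] [Fintype ι] {P : Measure Ω}
    [IsProbabilityMeasure P] {X : ι → Ω → ℝ} (hind : iIndepFun X P) (hX : ∀ i, Measurable (X i))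
    {σ V t : ℝ} (hσ : 0 < σ) (hV : 0 < V) (ht : 0 ≤ t) (htV : 2 * t * V < 1)
    (hmgf : ∀ i s, |s| * σ < 1 → Integrable (fun ω => Real.exp (s * X i ω)) P ∧
      ∫ ω, Real.exp (s * X i ω) ∂P ≤ Real.exp (σ ^ 2 * s ^ 2 / 2))
    (w : ι → ℝ) (hw : ∀ i, |w i| ≤ V) (hw2 : ∑ i, w i ^ 2 ≤ V) :
    P {ω | σ * √(2 * t * V) < |∑ i, w i * X i ω|} ≤ ENNReal.ofReal (2 * Real.exp (-t)) := by
  have h1 := measureReal_weighted_sum_ge_le hind hX hσ hV ht htV hmgf w hw hw2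
  have h2 := measureReal_weighted_sum_ge_le hind hX hσ hV ht htV hmgf (fun i => -w i)
    (by simpa using hw) (by simpa using hw2)
  have hsub : {ω | σ * √(2 * t * V) < |∑ i, w i * X i ω|} ⊆
      {ω | σ * √(2 * t * V) ≤ ∑ i, w i * X i ω} ∪ {ω | σ * √(2 * t * V) ≤ ∑ i, -w i * X i ω} := by
    intro ω hω
    rcases lt_abs.1 hω.out with h | h
    · exact Or.inl h.le
    · right
      simp only [neg_mul, Finset.sum_neg_distrib]
      exact h.le
  rw [← ENNReal.ofReal_toReal (measure_ne_top P {ω | σ * √(2 * t * V) < |∑ i, w i * X i ω|})]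
  apply ENNReal.ofReal_le_ofReal
  have h3 := (measureReal_mono (μ := P) hsub).trans (measureReal_union_le _ _)
  have : P.real {ω | σ * √(2 * t * V) < |∑ i, w i * X i ω|} ≤ 2 * Real.exp (-t) := by linarith
  exact this

end ByzIFCA

/-! ### Nets of bounded sets -/

namespace ByzIFCA

/-- A bounded set in `ℝ^d` has an `r`-net of cardinality `O((diam / r)^d)`. -/
lemma exists_net {d : ℕ} (hd : 0 < d) {K : Set (Vec d)} (hK : Bornology.IsBounded K)
    (hne : K.Nonempty) {r : ℝ} (hr : 0 < r) :
    ∃ s : Finset (Vec d), (∀ u ∈ s, u ∈ K) ∧ (∀ x ∈ K, ∃ u ∈ s, ‖x - u‖ ≤ r) ∧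
      (s.card : ℝ) ≤ (2 * Metric.diam K * √d / r + 1) ^ d := by
  classical
  obtain ⟨x₀, hx₀⟩ := hne
  set D := Metric.diam K with hD
  have hD0 : 0 ≤ D := Metric.diam_nonneg
  have hsd : 0 < √(d : ℝ) := Real.sqrt_pos.2 (by exact_mod_cast hd)
  have hcoord : ∀ x ∈ K, ∀ h, |x h - x₀ h| ≤ D := by
    intro x hx h
    calc |x h - x₀ h| = ‖(x - x₀) h‖ := rfl
      _ ≤ ‖x - x₀‖ := PiLp.norm_apply_le _ _
      _ ≤ D := by rw [← dist_eq_norm]; exact Metric.dist_le_diam_of_mem hK hx hx₀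
  set M := ⌊2 * D * √d / r⌋₊ + 1 with hM
  -- The cell of `x` in a cubic grid of side `r / √d`; two points of one cell are at distance at
  -- most `r`.
  let φ : Vec d → Fin d → ℕ := fun x h => ⌊(x h - x₀ h + D) * √d / r⌋₊
  have hφ : ∀ x ∈ K, ∀ h, φ x h < M := by
    intro x hx h
    apply Nat.lt_succ_of_le
    apply Nat.floor_le_floor
    have := (abs_le.1 (hcoord x hx h)).2
    gcongr
    linarith
  -- Each occupied cell is represented by one of its points in `K`, not by its centre, because the
  -- tail assumption holds only on `Θ`. Empty cells get the dummy `x₀`.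
  let rep : (Fin d → Fin M) → Vec d := fun c =>
    if hc : ∃ x ∈ K, ∀ h, φ x h = c h then hc.choose else x₀
  refine ⟨Finset.univ.image rep, ?_, ?_, ?_⟩
  · intro u hu
    obtain ⟨c, -, rfl⟩ := Finset.mem_image.1 hu
    by_cases hc : ∃ x ∈ K, ∀ h, φ x h = c h
    · simp only [rep, dif_pos hc]
      exact hc.choose_spec.1
    · simp only [rep, dif_neg hc]
      exact hx₀
  · intro x hx
    let c : Fin d → Fin M := fun h => ⟨φ x h, hφ x hx h⟩
    have hc : ∃ x ∈ K, ∀ h, φ x h = c h := ⟨x, hx, fun h => rfl⟩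
    refine ⟨rep c, Finset.mem_image_of_mem _ (Finset.mem_univ _), ?_⟩
    have hrep : rep c = hc.choose := by simp only [rep, dif_pos hc]
    rw [hrep]
    obtain ⟨hu, hu2⟩ := hc.choose_spec
    set u := hc.choose
    have hco : ∀ h, |(x - u) h| ≤ r / √d := by
      intro h
      have h1 : φ u h = φ x h := hu2 h
      have p1 : 0 ≤ (x h - x₀ h + D) * √d / r := by
        have := (abs_le.1 (hcoord x hx h)).1
        have : 0 ≤ x h - x₀ h + D := by linarith
        positivity
      have p2 : 0 ≤ (u h - x₀ h + D) * √d / r := by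
        have := (abs_le.1 (hcoord u hu h)).1
        have : 0 ≤ u h - x₀ h + D := by linarith
        positivity
      have a1 := Nat.floor_le p1
      have a2 := Nat.lt_floor_add_one ((x h - x₀ h + D) * √d / r)
      have b1 := Nat.floor_le p2
      have b2 := Nat.lt_floor_add_one ((u h - x₀ h + D) * √d / r)
      have h2 : (⌊(u h - x₀ h + D) * √d / r⌋₊ : ℝ) = ⌊(x h - x₀ h + D) * √d / r⌋₊ := by
        exact_mod_cast h1
      have e : (x h - u h) * (√d / r)
          = (x h - x₀ h + D) * √d / r - (u h - x₀ h + D) * √d / r := by ring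
      have h3 : |(x h - u h) * (√d / r)| ≤ 1 := by
        rw [e, abs_le]; constructor <;> linarith
      rw [abs_mul, abs_of_pos (by positivity : 0 < √(d : ℝ) / r)] at h3
      rw [PiLp.sub_apply, le_div_iff₀ hsd]
      have h4 : |x h - u h| * √d = |x h - u h| * (√d / r) * r := by field_simp
      rw [h4]
      nlinarith
    calc ‖x - u‖ ≤ √d * (r / √d) := norm_le_sqrt_mul (by positivity) hco
      _ = r := by field_simp
  · have h1 : (Finset.univ.image rep).card ≤ M ^ d := by
      refine Finset.card_image_le.trans ?_
      simp
    calc ((Finset.univ.image rep).card : ℝ) ≤ (M : ℝ) ^ d := by exact_mod_cast h1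
      _ ≤ _ := by
        gcongr
        rw [hM]
        push_cast
        gcongr
        exact Nat.floor_le (by positivity)

end ByzIFCA

/-! ### Concentration at a fixed parameter -/

namespace ByzIFCA

variable {d k m : ℕ} {Z : Type*} [MeasurableSpace Z] {S : Setup d k m Z}

namespace Setup

lemma nmin_le {i : Fin m} (hi : i ∈ S.normal) : S.nmin ≤ S.n i :=
  ciInf_le (OrderBot.bddBelow _) (⟨i, hi⟩ : {i : Fin m // i ∈ S.normal})

lemma cluster_subset_normal (j : Fin k) : S.cluster j ⊆ S.normal := Finset.filter_subset _ _

lemma cl_eq_of_mem_cluster {j : Fin k} {i : Fin m} (hi : i ∈ S.cluster j) : S.cl i = j :=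
  (Finset.mem_filter.1 hi).2

lemma mem_cluster_cl {i : Fin m} (hi : i ∈ S.normal) : i ∈ S.cluster (S.cl i) :=
  Finset.mem_filter.2 ⟨hi, rfl⟩

lemma Standing.nmin_pos (hS : S.Standing) : 0 < S.nmin := by
  obtain ⟨i, hi⟩ := hS.cluster_nonempty ⟨0, by have := hS.two_le; omega⟩
  have : Nonempty {i : Fin m // i ∈ S.normal} := ⟨⟨i, cluster_subset_normal _ hi⟩⟩
  obtain ⟨i', hi'⟩ := ciInf_mem (fun i : {i : Fin m // i ∈ S.normal} => S.n i)
  unfold Setup.nmin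
  rw [← hi']
  exact hS.n_pos i' i'.2

lemma card_mul_nmin_le {I : Finset (Fin m)} (hI : I ⊆ S.normal) : I.card * S.nmin ≤ S.N := by
  calc I.card * S.nmin = ∑ _i ∈ I, S.nmin := by simp
    _ ≤ ∑ i ∈ I, S.n i := Finset.sum_le_sum fun i hi => nmin_le (hI hi)
    _ ≤ S.N := Finset.sum_le_sum_of_subset hI

lemma Standing.normal_nonempty (hS : S.Standing) : S.normal.Nonempty := by
  obtain ⟨i, hi⟩ := hS.cluster_nonempty ⟨0, by have := hS.two_le; omega⟩
  exact ⟨i, cluster_subset_normal _ hi⟩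

lemma Standing.card_normal_le (hS : S.Standing) : S.normal.card ≤ S.N :=
  (Nat.le_mul_of_pos_right _ hS.nmin_pos).trans (card_mul_nmin_le subset_rfl)

lemma Standing.nmin_le_N (hS : S.Standing) : S.nmin ≤ S.N :=
  (Nat.le_mul_of_pos_left _ hS.normal_nonempty.card_pos).trans (card_mul_nmin_le subset_rfl)

lemma sum_card_cluster : ∑ j, (S.cluster j).card = S.normal.card :=
  (Finset.card_eq_sum_card_fiberwise fun i _ => Finset.mem_coe.2 (Finset.mem_univ (S.cl i))).symm

lemma Standing.k_le_card_normal (hS : S.Standing) : k ≤ S.normal.card := by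
  rw [← sum_card_cluster]
  calc k = ∑ _j : Fin k, 1 := by simp
    _ ≤ _ := Finset.sum_le_sum fun j _ => (hS.cluster_nonempty j).card_pos

/-- The average over the machines in `I` of the `h`-th partial derivative of their empirical
losses. -/
noncomputable def avgPartial (x : S.Sample) (I : Finset (Fin m)) (h : Fin d) (θ : Vec d) : ℝ :=
  1 / (I.card : ℝ) * ∑ i ∈ I, 1 / (S.n i : ℝ) * ∑ l, S.partialLoss h θ (x i l)

/-- The loss at `z` is smooth with Lipschitz partial derivatives. -/
def RegularPoint (S : Setup d k m Z) (L : ℝ) (Lh : Fin d → ℝ) (z : Z) : Prop :=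
  Smooth L (fun θ => S.f θ z) ∧
    ∀ h x y, |S.partialLoss h x z - S.partialLoss h y z| ≤ Lh h * ‖x - y‖

/-- Averages of Lipschitz functions are Lipschitz. -/
lemma abs_avgPartial_sub_le {L : ℝ} {Lh : Fin d → ℝ} {x : S.Sample} {I : Finset (Fin m)}
    (hI : I.Nonempty) (hn : ∀ i ∈ I, 0 < S.n i) (hx : ∀ i ∈ I, ∀ l, S.RegularPoint L Lh (x i l))
    (h : Fin d) (θ u : Vec d) :
    |avgPartial x I h θ - avgPartial x I h u| ≤ Lh h * ‖θ - u‖ := by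
  have hc : (0 : ℝ) < I.card := by exact_mod_cast hI.card_pos
  have h1 : avgPartial x I h θ - avgPartial x I h u = 1 / (I.card : ℝ) * ∑ i ∈ I, 1 / (S.n i : ℝ) *
      ∑ l, (S.partialLoss h θ (x i l) - S.partialLoss h u (x i l)) := by
    simp only [avgPartial, Finset.sum_sub_distrib, mul_sub]
  have h2 : ∀ i ∈ I, |1 / (S.n i : ℝ) *
      ∑ l, (S.partialLoss h θ (x i l) - S.partialLoss h u (x i l))| ≤ Lh h * ‖θ - u‖ := by
    intro i hi
    have hni : (0 : ℝ) < S.n i := by exact_mod_cast hn i hi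
    rw [abs_mul, abs_of_pos (by positivity), one_div, inv_mul_le_iff₀ hni]
    refine (Finset.abs_sum_le_sum_abs _ _).trans ?_
    refine (Finset.sum_le_sum fun l _ => (hx i hi l).2 h θ u).trans ?_
    simp
  rw [h1, abs_mul, abs_of_pos (by positivity), one_div, inv_mul_le_iff₀ hc]
  refine (Finset.abs_sum_le_sum_abs _ _).trans ((Finset.sum_le_sum h2).trans ?_)
  simp

variable {Ω : Type*} [MeasurableSpace Ω] {P : Measure Ω} {b : ℕ}
  {z : Fin b → (i : Fin m) → Fin (S.n i) → Ω → Z}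

/-- Concentration of the average partial derivative of a group of machines of one cluster, at a
fixed parameter. -/
lemma IsData.measure_avgPartial_le [IsProbabilityMeasure P] (hz : S.IsData P z)
    (hS : S.Standing) {L : ℝ} {Lh : Fin d → ℝ} (hL : S.LossRegular L Lh) {σ t : ℝ} (hσ : 0 < σ)
    (hsub : S.SubExpGradient σ) (ht : 0 ≤ t) (htn : 2 * t < S.nmin) (r : Fin b) (j : Fin k)
    {I : Finset (Fin m)} (hI : I.Nonempty) (hIj : I ⊆ S.cluster j) {u : Vec d} (hu : u ∈ S.Θ)
    (h : Fin d) :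
    P {ω | σ * √(2 * t / (I.card * S.nmin)) <
        |avgPartial (fun i l => z r i l ω) I h u - gradient (S.popLoss j) u h|}
      ≤ ENNReal.ofReal (2 * Real.exp (-t)) := by
  have hIn : I ⊆ S.normal := hIj.trans (cluster_subset_normal j)
  set ψ := S.partialLoss h u with hψ
  obtain ⟨hψi, hψm⟩ := hsub j h u hu
  have hψae : AEMeasurable ψ (S.dist j) := hψi.aemeasurable
  set μ := ∫ y, ψ y ∂(S.dist j) with hμ
  have hgrad : gradient (S.popLoss j) u h = μ :=
    gradient_popLoss_apply hS hL j (fun h => (hsub j h u hu).1) h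
  -- The partial derivative is known to be measurable only up to a null set, whereas independence
  -- passes through measurable maps. A measurable version agrees with it almost surely at the
  -- finitely many data points.
  set G := hψae.mk ψ with hG
  have hGm : Measurable G := hψae.measurable_mk
  have hGae : ψ =ᵐ[S.dist j] G := hψae.ae_eq_mk
  let ι := Σ i : {i : Fin m // i ∈ I}, Fin (S.n i)
  let e : ι → Fin b × (Σ i : {i : Fin m // i ∈ S.normal}, Fin (S.n i)) :=
    fun q => (r, ⟨⟨q.1.1, hIn q.1.2⟩, q.2⟩)
  have he : Function.Injective e := by
    rintro ⟨⟨i, hi⟩, l⟩ ⟨⟨i', hi'⟩, l'⟩ heq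
    simp only [e, Prod.mk.injEq, true_and, Sigma.mk.injEq, Subtype.mk.injEq] at heq
    obtain ⟨rfl, hll⟩ := heq
    simp only [heq_eq_eq] at hll
    rw [hll]
  have hlaw : ∀ q : ι, P.map (z r q.1 q.2) = S.dist j := fun q => by
    rw [hz.law r q.1 (hIn q.1.2) q.2, cl_eq_of_mem_cluster (hIj q.1.2)]
  have hzm : ∀ q : ι, Measurable (z r q.1 q.2) := fun q => hz.meas r q.1 (hIn q.1.2) q.2
  let X : ι → Ω → ℝ := fun q ω => G (z r q.1 q.2 ω) - μ
  have hXind : iIndepFun X P :=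
    (hz.indep.precomp he).comp (fun _ x => G x - μ) fun _ => hGm.sub_const _
  have hXm : ∀ q, Measurable (X q) := fun q => (hGm.comp (hzm q)).sub_const _
  have hXmgf : ∀ q s, |s| * σ < 1 → Integrable (fun ω => Real.exp (s * X q ω)) P ∧
      ∫ ω, Real.exp (s * X q ω) ∂P ≤ Real.exp (σ ^ 2 * s ^ 2 / 2) := by
    intro q s hs
    obtain ⟨h1, h2⟩ := hψm s hs
    have hae : (fun y => Real.exp (s * (ψ y - μ))) =ᵐ[S.dist j]
        fun y => Real.exp (s * (G y - μ)) := by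
      filter_upwards [hGae] with y hy
      rw [hy]
    rw [integral_congr_ae hae] at h2
    replace h1 := h1.congr hae
    rw [← hlaw q] at h1 h2
    rw [integral_map (hzm q).aemeasurable h1.aestronglyMeasurable] at h2
    exact ⟨h1.comp_measurable (hzm q), h2⟩
  have hc : (0 : ℝ) < I.card := by exact_mod_cast hI.card_pos
  have hc1 : (1 : ℝ) ≤ I.card := by exact_mod_cast hI.card_pos
  have hn0 : (0 : ℝ) < S.nmin := by exact_mod_cast hS.nmin_pos
  have hnle : ∀ i ∈ I, (S.nmin : ℝ) ≤ S.n i := fun i hi => by exact_mod_cast nmin_le (hIn hi)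
  -- The weights are positive, sum to 1 and are at most `V`, so `V` bounds the sum of their squares
  -- too, even when the sample sizes differ.
  set V : ℝ := 1 / (I.card * S.nmin) with hV
  have hV0 : 0 < V := by positivity
  have htV : 2 * t * V < 1 := by
    rw [hV, mul_one_div, div_lt_one (by positivity)]
    nlinarith
  let w : ι → ℝ := fun q => 1 / (I.card * S.n q.1)
  have hw : ∀ q, |w q| ≤ V := by
    intro q
    have h1 := hnle q.1 q.1.2
    rw [abs_of_nonneg (by positivity)]
    simp only [w, hV]
    gcongr
  have hw2 : ∑ q, w q ^ 2 ≤ V := by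
    rw [Fintype.sum_sigma]
    calc ∑ i : {i // i ∈ I}, ∑ l : Fin (S.n i), (1 / ((I.card : ℝ) * S.n i)) ^ 2
        = ∑ i : {i // i ∈ I}, 1 / ((I.card : ℝ) ^ 2 * S.n i) := by
          refine Finset.sum_congr rfl fun i _ => ?_
          have : (0 : ℝ) < S.n i := hn0.trans_le (hnle i i.2)
          rw [Finset.sum_const, Finset.card_univ, Fintype.card_fin, nsmul_eq_mul]
          field_simp
      _ ≤ ∑ i : {i // i ∈ I}, 1 / ((I.card : ℝ) ^ 2 * S.nmin) := by
          refine Finset.sum_le_sum fun i _ => ?_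
          have := hnle i i.2
          gcongr
      _ = V := by
          rw [Finset.sum_const, Finset.card_univ, Fintype.card_coe, nsmul_eq_mul, hV]
          field_simp
  have hmain := measure_lt_abs_weighted_sum_le hXind hXm hσ hV0 ht htV hXmgf w hw hw2
  refine le_trans (measure_mono_ae ?_) hmain
  have hall : ∀ᵐ ω ∂P, ∀ q : ι, ψ (z r q.1 q.2 ω) = G (z r q.1 q.2 ω) := by
    rw [ae_all_iff]
    intro q
    have := hGae
    rw [← hlaw q] at this
    exact ae_of_ae_map (hzm q).aemeasurable this
  filter_upwards [hall] with ω hω hbad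
  have hsum : ∑ q, w q * X q ω = avgPartial (fun i l => z r i l ω) I h u - μ := by
    rw [Fintype.sum_sigma]
    have h1 : ∀ i : {i // i ∈ I}, ∑ l : Fin (S.n i), w ⟨i, l⟩ * X ⟨i, l⟩ ω
        = 1 / (I.card : ℝ) * (1 / (S.n i : ℝ) * ∑ l, ψ (z r i l ω)) - 1 / (I.card : ℝ) * μ := by
      intro i
      have h0 : (0 : ℝ) < S.n i := hn0.trans_le (hnle i i.2)
      change ∑ l, 1 / ((I.card : ℝ) * S.n i) * (G (z r i l ω) - μ) = _
      rw [← Finset.mul_sum, Finset.sum_sub_distrib, Finset.sum_const, Finset.card_univ,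
        Fintype.card_fin, nsmul_eq_mul, Finset.sum_congr rfl fun l _ => hω ⟨i, l⟩]
      field_simp
    rw [Finset.sum_congr rfl fun i _ => h1 i, Finset.sum_sub_distrib, Finset.sum_const,
      Finset.card_univ, Fintype.card_coe, nsmul_eq_mul, ← Finset.mul_sum,
      Finset.sum_coe_sort I (fun i => 1 / (S.n i : ℝ) * ∑ l, ψ (z r i l ω))]
    unfold avgPartial
    simp only [← hψ]
    field_simp
  have hbad' : σ * √(2 * t / (I.card * S.nmin)) <
      |avgPartial (fun i l => z r i l ω) I h u - gradient (S.popLoss j) u h| := hbad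
  change σ * √(2 * t * V) < |∑ q, w q * X q ω|
  rw [hsum, ← hgrad, hV, mul_one_div]
  exact hbad'

end Setup

end ByzIFCA

/-! ### Uniform concentration -/

namespace ByzIFCA

variable {d k m : ℕ} {Z : Type*} [MeasurableSpace Z] {S : Setup d k m Z}

namespace Setup

/-- On the sample `x` all losses are regular and, uniformly over `Θ`, the partial derivatives of the
empirical losses are close to those of the population losses, both for every machine and for
the average over every cluster. -/
structure Concentrated (S : Setup d k m Z) (L : ℝ) (Lh : Fin d → ℝ) (κ : ℝ) (x : S.Sample) :
    Prop where
  regular : ∀ i ∈ S.normal, ∀ l, S.RegularPoint L Lh (x i l)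
  single : ∀ i ∈ S.normal, ∀ θ ∈ S.Θ, ∀ h,
    |avgPartial x {i} h θ - gradient (S.popLoss (S.cl i)) θ h| ≤ κ / √(S.nmin)
  cluster : ∀ j, ∀ θ ∈ S.Θ, ∀ h,
    |avgPartial x (S.cluster j) h θ - gradient (S.popLoss j) θ h|
      ≤ κ / √((S.cluster j).card * S.nmin)

/-- The groups of machines over which averages are taken, with the cluster they belong to. -/
def groups (S : Setup d k m Z) : Finset (Fin k × Finset (Fin m)) :=
  Finset.univ.image (fun j => (j, S.cluster j)) ∪ S.normal.image (fun i => (S.cl i, {i}))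

/-- Every cluster contains a normal machine and every normal machine a data point, so there are at
most `N` groups of either kind. -/
lemma Standing.card_groups_le (hS : S.Standing) : S.groups.card ≤ 2 * S.N := by
  have h1 := hS.k_le_card_normal
  have h2 := hS.card_normal_le
  calc S.groups.card ≤ _ + _ := Finset.card_union_le _ _
    _ ≤ k + S.normal.card := by
        gcongr
        · exact Finset.card_image_le.trans (by simp)
        · exact Finset.card_image_le
    _ ≤ 2 * S.N := by omega

lemma Standing.nonempty_of_mem_groups (hS : S.Standing) {q : Fin k × Finset (Fin m)}
    (hq : q ∈ S.groups) : q.2.Nonempty ∧ q.2 ⊆ S.cluster q.1 := by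
  rcases Finset.mem_union.1 hq with h | h
  · obtain ⟨j, -, rfl⟩ := Finset.mem_image.1 h
    exact ⟨hS.cluster_nonempty j, subset_rfl⟩
  · obtain ⟨i, hi, rfl⟩ := Finset.mem_image.1 h
    exact ⟨Finset.singleton_nonempty i, Finset.singleton_subset_iff.2 (mem_cluster_cl hi)⟩

/-- A deviation bound on a net extends to all of `Θ`. -/
lemma abs_avgPartial_sub_gradient_le (hS : S.Standing) {L : ℝ} {Lh : Fin d → ℝ}
    (hL : S.LossRegular L Lh) {σ t r₀ : ℝ} (hσ : 0 < σ) (hsub : S.SubExpGradient σ)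
    (ht : 1 ≤ 2 * t) (hr₀ : ∀ h, Lh h * r₀ ≤ σ / S.N) (hLh : ∀ h, 0 ≤ Lh h)
    {net : Finset (Vec d)} (hnetΘ : ∀ u ∈ net, u ∈ S.Θ) (hnet : ∀ θ ∈ S.Θ, ∃ u ∈ net, ‖θ - u‖ ≤ r₀)
    {x : S.Sample} (hx : ∀ i ∈ S.normal, ∀ l, S.RegularPoint L Lh (x i l)) {j : Fin k}
    {I : Finset (Fin m)} (hI : I.Nonempty) (hIj : I ⊆ S.cluster j) (h : Fin d)
    (hdev : ∀ u ∈ net, |avgPartial x I h u - gradient (S.popLoss j) u h|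
      ≤ σ * √(2 * t / (I.card * S.nmin))) {θ : Vec d} (hθ : θ ∈ S.Θ) :
    |avgPartial x I h θ - gradient (S.popLoss j) θ h|
      ≤ 3 * σ * √(2 * t) / √(I.card * S.nmin) := by
  have hIn : I ⊆ S.normal := hIj.trans (cluster_subset_normal j)
  obtain ⟨u, hu, hθu⟩ := hnet θ hθ
  have h1 := abs_avgPartial_sub_le hI (fun i hi => hS.n_pos i (hIn hi))
    (fun i hi => hx i (hIn hi)) h θ u
  have h2 := abs_gradient_popLoss_sub_le hS hL j (fun h => (hsub j h θ hθ).1)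
    (fun h => (hsub j h u (hnetΘ u hu)).1) h
  have h3 := hdev u hu
  have h4 : Lh h * ‖θ - u‖ ≤ σ / S.N :=
    (mul_le_mul_of_nonneg_left hθu (hLh h)).trans (hr₀ h)
  have hprod : (1 : ℝ) ≤ I.card * S.nmin := by
    exact_mod_cast Nat.mul_pos hI.card_pos hS.nmin_pos
  have hs1 : 1 ≤ √((I.card : ℝ) * S.nmin) := Real.one_le_sqrt.2 hprod
  have hsN : √((I.card : ℝ) * S.nmin) ≤ S.N := by
    refine (Real.sqrt_le_left (by positivity)).2 ?_
    have h5 : ((I.card : ℝ) * S.nmin) ≤ S.N := by exact_mod_cast card_mul_nmin_le hIn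
    nlinarith
  -- Passing from `θ` to the net costs `σ / N` twice, once for the empirical and once for the
  -- population derivative. As `√(|I| n_min) ≤ N`, each cost is at most the deviation itself, whence
  -- the factor 3.
  have h6 : σ / S.N ≤ σ * √(2 * t / (I.card * S.nmin)) := by
    rw [Real.sqrt_div (by linarith), mul_div_assoc']
    have : 1 ≤ √(2 * t) := Real.one_le_sqrt.2 ht
    exact div_le_div₀ (by positivity) (le_mul_of_one_le_right hσ.le this) (by linarith) hsN
  have h7 : 3 * σ * √(2 * t) / √(I.card * S.nmin) = 3 * (σ * √(2 * t / (I.card * S.nmin))) := by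
    rw [Real.sqrt_div (by linarith)]
    ring
  rw [h7]
  rw [abs_le] at *
  constructor <;> linarith [h1.1, h1.2, h2.1, h2.2, h3.1, h3.2]

variable {Ω : Type*} [MeasurableSpace Ω] {P : Measure Ω} {b : ℕ}
  {z : Fin b → (i : Fin m) → Fin (S.n i) → Ω → Z}

/-- With high probability all batches are concentrated. -/
lemma IsData.measure_not_concentrated_le [IsProbabilityMeasure P] (hz : S.IsData P z)
    (hS : S.Standing) (hd : 0 < d) {L : ℝ} {Lh : Fin d → ℝ} (hL : S.LossRegular L Lh) {σ t : ℝ}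
    (hσ : 0 < σ) (hsub : S.SubExpGradient σ) (ht : 1 ≤ 2 * t) (htn : 2 * t < S.nmin)
    (hLh : ∀ h, 0 ≤ Lh h) (hLf : 0 < √(∑ h, Lh h ^ 2)) :
    P {ω | ¬ ∀ r, S.Concentrated L Lh (3 * σ * √(2 * t)) (fun i l => z r i l ω)} ≤
      ENNReal.ofReal (4 * b * S.N * d *
        (2 * S.D * √d * (S.N * √(∑ h, Lh h ^ 2)) / σ + 1) ^ d * Real.exp (-t)) := by
  classical
  set Lf := √(∑ h, Lh h ^ 2) with hLf'
  have hN : (0 : ℝ) < S.N := by exact_mod_cast hS.nmin_pos.trans_le hS.nmin_le_N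
  -- At this net radius every partial derivative varies by at most `σ / N` between a point and its
  -- net neighbour.
  have hr0 : 0 < σ / (S.N * Lf) := by positivity
  obtain ⟨net, hnetΘ, hnet, hcard⟩ := exists_net hd hS.compact.isBounded
    ⟨_, hS.opt_mem ⟨0, by have := hS.two_le; omega⟩⟩ hr0
  have hr₀ : ∀ h, Lh h * (σ / (S.N * Lf)) ≤ σ / S.N := by
    intro h
    have h1 : Lh h ≤ Lf := by
      rw [hLf', Real.le_sqrt (hLh h) (Finset.sum_nonneg fun _ _ => sq_nonneg _)]
      exact Finset.single_le_sum (f := fun h => Lh h ^ 2) (fun _ _ => sq_nonneg _)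
        (Finset.mem_univ h)
    calc Lh h * (σ / (S.N * Lf)) ≤ Lf * (σ / (S.N * Lf)) := by gcongr
      _ = σ / S.N := by field_simp
  let bad : Fin b × (Fin k × Finset (Fin m)) × Vec d × Fin d → Set Ω := fun q =>
    {ω | σ * √(2 * t / (q.2.1.2.card * S.nmin)) <
        |avgPartial (fun i l => z q.1 i l ω) q.2.1.2 q.2.2.2 q.2.2.1
          - gradient (S.popLoss q.2.1.1) q.2.2.1 q.2.2.2|}
  let s : Finset (Fin b × (Fin k × Finset (Fin m)) × Vec d × Fin d) :=
    Finset.univ ×ˢ S.groups ×ˢ net ×ˢ Finset.univ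
  have hbad : ∀ q ∈ s, P (bad q) ≤ ENNReal.ofReal (2 * Real.exp (-t)) := by
    intro q hq
    simp only [s, Finset.mem_product, Finset.mem_univ, true_and, and_true] at hq
    obtain ⟨hne, hsubc⟩ := hS.nonempty_of_mem_groups hq.1
    exact hz.measure_avgPartial_le hS hL hσ hsub (by linarith) htn q.1 q.2.1.1 hne hsubc
      (hnetΘ _ hq.2) q.2.2.2
  have hscard : (s.card : ℝ) ≤
      2 * b * S.N * d * (2 * S.D * √d * (S.N * Lf) / σ + 1) ^ d := by
    have h1 : s.card = b * (S.groups.card * (net.card * d)) := by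
      simp [s, Finset.card_product]
    have h2 : (S.groups.card : ℝ) ≤ 2 * S.N := by exact_mod_cast hS.card_groups_le
    have h3 : (net.card : ℝ) ≤ (2 * S.D * √d * (S.N * Lf) / σ + 1) ^ d := by
      refine hcard.trans_eq ?_
      unfold Setup.D
      congr 2
      field_simp
    rw [h1]
    push_cast
    calc (b : ℝ) * (S.groups.card * (net.card * d))
        ≤ b * ((2 * S.N) * ((2 * S.D * √d * (S.N * Lf) / σ + 1) ^ d * d)) := by gcongr
      _ = _ := by ring
  have hreg : ∀ᵐ ω ∂P, ∀ r, ∀ i, i ∈ S.normal → ∀ l, S.RegularPoint L Lh (z r i l ω) := by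
    simp only [ae_all_iff]
    intro r i hi l
    have := hL (S.cl i)
    rw [← hz.law r i hi l] at this
    exact ae_of_ae_map (hz.meas r i hi l).aemeasurable this
  have hsubset : ∀ᵐ ω ∂P,
      ω ∈ {ω | ¬ ∀ r, S.Concentrated L Lh (3 * σ * √(2 * t)) (fun i l => z r i l ω)} →
        ω ∈ ⋃ q ∈ s, bad q := by
    filter_upwards [hreg] with ω hω hnot
    by_contra hnb
    apply hnot
    have hdev : ∀ r, ∀ q ∈ S.groups, ∀ h, ∀ θ ∈ S.Θ,
        |avgPartial (fun i l => z r i l ω) q.2 h θ - gradient (S.popLoss q.1) θ h|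
          ≤ 3 * σ * √(2 * t) / √(q.2.card * S.nmin) := by
      intro r q hq h θ hθ
      obtain ⟨hne, hsubc⟩ := hS.nonempty_of_mem_groups hq
      refine abs_avgPartial_sub_gradient_le hS hL hσ hsub ht hr₀ hLh hnetΘ hnet (hω r) hne hsubc h
        (fun u hu => ?_) hθ
      by_contra hlt
      apply hnb
      simp only [Set.mem_iUnion]
      refine ⟨(r, q, u, h), ?_, ?_⟩
      · simp [s, hq, hu]
      · exact not_le.1 hlt
    intro r
    refine ⟨hω r, fun i hi θ hθ h => ?_, fun j θ hθ h => ?_⟩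
    · have := hdev r (S.cl i, {i})
        (Finset.mem_union_right _ (Finset.mem_image_of_mem _ hi)) h θ hθ
      simpa using this
    · exact hdev r (j, S.cluster j)
        (Finset.mem_union_left _ (Finset.mem_image_of_mem _ (Finset.mem_univ j))) h θ hθ
  refine (measure_mono_ae hsubset).trans ((measure_biUnion_finset_le s bad).trans ?_)
  refine (Finset.sum_le_sum hbad).trans ?_
  rw [Finset.sum_const, nsmul_eq_mul, ← ENNReal.ofReal_natCast, ← ENNReal.ofReal_mul (by positivity)]
  apply ENNReal.ofReal_le_ofReal
  have h1 := Real.exp_pos (-t)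
  nlinarith

end Setup

end ByzIFCA

/-! ### Runs on concentrated samples -/

namespace ByzIFCA

variable {d k m : ℕ} {Z : Type*} [MeasurableSpace Z] {S : Setup d k m Z}

namespace Setup

lemma Δ_le {j j' : Fin k} (h : j ≠ j') : S.Δ ≤ ‖S.opt j - S.opt j'‖ :=
  ciInf_le (f := fun q : {q : Fin k × Fin k // q.1 ≠ q.2} => ‖S.opt q.1.1 - S.opt q.1.2‖)
    ⟨0, by rintro _ ⟨q, rfl⟩; exact norm_nonneg _⟩ ⟨(j, j'), h⟩

lemma p_le (j : Fin k) : S.p ≤ (S.cluster j).card / m :=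
  ciInf_le (f := fun j => ((S.cluster j).card : ℝ) / (m : ℝ)) (Set.finite_range _).bddBelow j

lemma Standing.m_pos (hS : S.Standing) : 0 < m := by
  obtain ⟨i, -⟩ := hS.normal_nonempty
  exact i.pos

lemma p_mul_le (hS : S.Standing) (j : Fin k) : S.p * m ≤ (S.cluster j).card := by
  have hm : (0 : ℝ) < m := by exact_mod_cast hS.m_pos
  exact (le_div_iff₀ hm).1 (p_le j)

lemma Standing.one_le_p_mul (hS : S.Standing) : 1 ≤ S.p * m := by
  have hm : (0 : ℝ) < m := by exact_mod_cast hS.m_pos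
  have : Nonempty (Fin k) := ⟨⟨0, by have := hS.two_le; omega⟩⟩
  rw [← div_le_iff₀ hm]
  refine le_ciInf fun j => ?_
  have : (1 : ℝ) ≤ (S.cluster j).card := by exact_mod_cast (hS.cluster_nonempty j).card_pos
  gcongr

/-- The gradient of the empirical loss of a regular sample is the average of the partial
derivatives. -/
lemma gradient_empLoss_eq_avgPartial {L : ℝ} {Lh : Fin d → ℝ} {x : S.Sample} {i : Fin m}
    (hx : ∀ l, S.RegularPoint L Lh (x i l)) (θ : Vec d) (h : Fin d) :
    gradient (S.empLoss (x i)) θ h = avgPartial x {i} h θ := by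
  rw [gradient_empLoss_apply (x i) θ fun l => (hx l).1.1 θ]
  simp [avgPartial]

/-- On a concentrated sample no normal machine errs in the estimation of its cluster, if the
current parameters are close to the targets. -/
lemma Concentrated.estimate_eq (hS : S.Standing) {lamF LF : ℝ} (hlam : 0 < lamF)
    (hlL : lamF ≤ LF) (hF : S.PopRegular lamF LF) {L κ : ℝ} {Lh : Fin d → ℝ} {x : S.Sample}
    (hx : S.Concentrated L Lh κ x) (hκ : 0 ≤ κ)
    (hgap : √d * (κ / √(S.nmin)) * S.D < lamF * S.Δ ^ 2 / 4) (hΔ : 0 ≤ S.Δ)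
    {θ : Fin k → Vec d}
    (hθ : ∀ j, θ j ∈ S.Θ) (hclose : ∀ j, ‖θ j - S.opt j‖ ≤ 1 / 4 * √(lamF / LF) * S.Δ)
    {i : Fin m} (hi : i ∈ S.normal) {J : Fin k}
    (hJ : ∀ j, S.empLoss (x i) (θ J) ≤ S.empLoss (x i) (θ j)) : J = S.cl i := by
  by_contra hne
  set j := S.cl i with hj
  have hL0 : 0 < LF := hlam.trans_le hlL
  set s := √(lamF / LF) with hs
  have hs2 : s ^ 2 = lamF / LF := Real.sq_sqrt (by positivity)
  have hs0 : 0 ≤ s := Real.sqrt_nonneg _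
  have hs1 : s ≤ 1 := Real.sqrt_le_one.2 ((div_le_one hL0).2 hlL)
  obtain ⟨hsc, hsm⟩ := hF j
  have hup := hsm.upper (S.opt j) (θ j)
  have hlo := hsc.2 (S.opt j) (θ J)
  rw [hS.opt_stat j, inner_zero_left] at hup hlo
  -- The population loss exceeds its minimum by at most `λ_F Δ² / 32` at the right parameter and, by
  -- `h3`, by at least `9 λ_F Δ² / 32` at the wrong one. The difference `λ_F Δ² / 4` is the
  -- threshold in `hgap`.
  have h1 : LF / 2 * ‖θ j - S.opt j‖ ^ 2 ≤ lamF * S.Δ ^ 2 / 32 := by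
    have : ‖θ j - S.opt j‖ ^ 2 ≤ (1 / 4 * s * S.Δ) ^ 2 :=
      pow_le_pow_left₀ (norm_nonneg _) (hclose j) 2
    calc LF / 2 * ‖θ j - S.opt j‖ ^ 2 ≤ LF / 2 * (1 / 4 * s * S.Δ) ^ 2 := by gcongr
      _ = LF / 32 * (s ^ 2) * S.Δ ^ 2 := by ring
      _ = lamF * S.Δ ^ 2 / 32 := by rw [hs2]; field_simp
  have h2 : 3 / 4 * S.Δ ≤ ‖θ J - S.opt j‖ := by
    have a1 := Δ_le (S := S) hne
    have a2 := hclose J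
    have a3 : ‖S.opt J - S.opt j‖ ≤ ‖θ J - S.opt J‖ + ‖θ J - S.opt j‖ := by
      have : S.opt J - S.opt j = -(θ J - S.opt J) + (θ J - S.opt j) := by abel
      rw [this, ← norm_neg (θ J - S.opt J)]
      exact norm_add_le _ _
    have a4 : 1 / 4 * s * S.Δ ≤ 1 / 4 * S.Δ := by nlinarith
    linarith
  have h3 : lamF / 2 * (3 / 4 * S.Δ) ^ 2 ≤ lamF / 2 * ‖θ J - S.opt j‖ ^ 2 := by gcongr
  -- Only differences of losses matter, so the mean value inequality for `H` turns gradient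
  -- concentration into the required comparison of losses.
  set H : Vec d → ℝ := fun y => S.empLoss (x i) y - S.popLoss j y with hH
  have hed : Differentiable ℝ (S.empLoss (x i)) :=
    differentiable_empLoss (x i) fun l => (hx.regular i hi l).1.1
  have hHd : Differentiable ℝ H := hed.sub hsc.1
  have hHg : ∀ y ∈ S.Θ, ‖gradient H y‖ ≤ √d * (κ / √(S.nmin)) := by
    intro y hy
    refine norm_le_sqrt_mul (by positivity) fun h => ?_
    have e : gradient H y = gradient (S.empLoss (x i)) y - gradient (S.popLoss j) y := by
      unfold gradient
      rw [hH, fderiv_fun_sub (hed y) (hsc.1 y), map_sub]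
    rw [e, PiLp.sub_apply, gradient_empLoss_eq_avgPartial (hx.regular i hi)]
    exact hx.single i hi y hy h
  have h4 := abs_sub_le_of_gradient_le hHd hS.convex hHg (hθ j) (hθ J)
  have h5 : ‖θ J - θ j‖ ≤ S.D := by
    rw [← dist_eq_norm]
    exact Metric.dist_le_diam_of_mem hS.compact.isBounded (hθ J) (hθ j)
  have h6 : √d * (κ / √(S.nmin)) * ‖θ J - θ j‖ ≤ √d * (κ / √(S.nmin)) * S.D := by gcongr
  have h7 := hJ j
  have h8 := (abs_le.1 h4).1
  simp only [hH] at h8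
  nlinarith

/-- On a concentrated sample and with correctly estimated clusters, the trimmed mean of the
messages is close to the gradient of the population loss. -/
lemma Concentrated.norm_trmean_sub_le (hS : S.Standing) {L κ β ε : ℝ} {Lh : Fin d → ℝ}
    {x : S.Sample} (hx : S.Concentrated L Lh κ x) (hκ : 0 ≤ κ) (hε : 0 < ε) (hβ0 : 0 ≤ β)
    (hβ : β ≤ 1 / 2 - ε) (hα : S.alpha ≤ β * S.p) {θ : Fin k → Vec d} (hθ : ∀ j, θ j ∈ S.Θ)
    {J : Fin m → Fin k} {g : Fin m → Vec d} (hJ : ∀ i ∈ S.normal, J i = S.cl i)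
    (hg : ∀ i ∈ S.normal, g i = gradient (S.empLoss (x i)) (θ (J i))) (j : Fin k) :
    ‖trmean β (Finset.univ.filter (fun i => J i = j)) g - gradient (S.popLoss j) (θ j)‖ ≤
      √d * ((κ / √(S.p * m * S.nmin) + 3 * β * (κ / √(S.nmin))) / (2 * ε)) := by
  classical
  have hm : (0 : ℝ) < m := by exact_mod_cast hS.m_pos
  have hn0 : (0 : ℝ) < S.nmin := by exact_mod_cast hS.nmin_pos
  have hpm := hS.one_le_p_mul
  have hpm0 : 0 < S.p * m := by linarith
  refine norm_le_sqrt_mul (by positivity) fun h => ?_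
  set I := Finset.univ.filter (fun i => J i = j) with hI
  have hGI : S.cluster j ⊆ I := fun i hi => by
    rw [hI, Finset.mem_filter]
    exact ⟨Finset.mem_univ i, (hJ i (cluster_subset_normal j hi)).trans (cl_eq_of_mem_cluster hi)⟩
  have hgi : ∀ i ∈ S.cluster j, g i h = avgPartial x {i} h (θ j) := by
    intro i hi
    have hin := cluster_subset_normal j hi
    rw [hg i hin, hJ i hin, cl_eq_of_mem_cluster hi,
      gradient_empLoss_eq_avgPartial (hx.regular i hin)]
  have hGc : (0 : ℝ) < (S.cluster j).card := by exact_mod_cast (hS.cluster_nonempty j).card_pos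
  rw [PiLp.sub_apply]
  change |trimmedMean β (I.val.map (fun i => g i h)) - gradient (S.popLoss j) (θ j) h| ≤ _
  refine abs_trimmedMean_map_sub_le I (S.cluster j) hGI (fun i => g i h) (by positivity) hε hβ0 hβ
    (hS.cluster_nonempty j) ?_ ?_ ?_
  · intro i hi
    have := hx.single i (cluster_subset_normal j hi) (θ j) (hθ j) h
    rw [cl_eq_of_mem_cluster hi] at this
    rw [hgi i hi]
    exact this
  -- `avgPartial` weights machines equally, irrespective of sample size, so it is exactly the mean
  -- of their messages.
  · have h1 : ∑ i ∈ S.cluster j, (g i h - gradient (S.popLoss j) (θ j) h)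
        = (S.cluster j).card *
          (avgPartial x (S.cluster j) h (θ j) - gradient (S.popLoss j) (θ j) h) := by
      rw [Finset.sum_sub_distrib, Finset.sum_congr rfl hgi, Finset.sum_const, nsmul_eq_mul]
      have : ∀ i, avgPartial x {i} h (θ j)
          = 1 / (S.n i : ℝ) * ∑ l, S.partialLoss h (θ j) (x i l) := fun i => by simp [avgPartial]
      simp only [this]
      unfold avgPartial
      field_simp
    rw [h1, abs_mul, abs_of_pos hGc]
    refine mul_le_mul_of_nonneg_left ((hx.cluster j (θ j) (hθ j) h).trans ?_) hGc.le
    have := p_mul_le hS j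
    gcongr
  -- Since no normal machine errs, outsiders are Byzantine: at most `α m ≤ β p m ≤ β |S_j^*| ≤ β
  -- |I|` of them.
  · have h1 : I \ S.cluster j ⊆ S.byz := by
      intro i hi
      rw [Finset.mem_sdiff, hI, Finset.mem_filter] at hi
      by_contra hb
      have hin : i ∈ S.normal := Finset.mem_filter.2 ⟨Finset.mem_univ i, hb⟩
      exact hi.2 (Finset.mem_filter.2 ⟨hin, (hJ i hin).symm.trans hi.1.2⟩)
    have h2 : ((I \ S.cluster j).card : ℝ) ≤ S.byz.card := by
      exact_mod_cast Finset.card_le_card h1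
    have h3 : (S.byz.card : ℝ) = S.alpha * m := by
      unfold Setup.alpha; field_simp
    have h4 : ((S.cluster j).card : ℝ) ≤ I.card := by exact_mod_cast Finset.card_le_card hGI
    calc ((I \ S.cluster j).card : ℝ) ≤ S.alpha * m := h3 ▸ h2
      _ ≤ β * S.p * m := by gcongr
      _ = β * (S.p * m) := by ring
      _ ≤ β * I.card := by
        have := p_mul_le hS j
        gcongr
        linarith

/-- Linear convergence of a run on concentrated samples up to the aggregation error `W`. -/
lemma IsRun.norm_sub_opt_le (hS : S.Standing) {lamF LF : ℝ} (hlam : 0 < lamF)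
    (hlL : lamF ≤ LF) (hF : S.PopRegular lamF LF) {L κ β ε W : ℝ} {Lh : Fin d → ℝ}
    (hκ : 0 ≤ κ) (hgap : √d * (κ / √(S.nmin)) * S.D < lamF * S.Δ ^ 2 / 4) (hΔ : 0 ≤ S.Δ)
    (hε : 0 < ε) (hβ0 : 0 ≤ β) (hβ : β ≤ 1 / 2 - ε) (hα : S.alpha ≤ β * S.p)
    (hW : √d * ((κ / √(S.p * m * S.nmin) + 3 * β * (κ / √(S.nmin))) / (2 * ε)) ≤ W)
    (hWΔ : W / LF ≤ lamF / (lamF + LF) * (1 / 4 * √(lamF / LF) * S.Δ))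
    {init : Fin k → Vec d} (hinit : ∀ j, init j ∈ S.Θ)
    (hclose : ∀ j, ‖init j - S.opt j‖ ≤ 1 / 4 * √(lamF / LF) * S.Δ)
    {xc xg : ℕ → S.Sample} (hxc : ∀ t, S.Concentrated L Lh κ (xc t))
    (hxg : ∀ t, S.Concentrated L Lh κ (xg t)) {T : ℕ} {θ : ℕ → Fin k → Vec d}
    {J : ℕ → Fin m → Fin k} {g : ℕ → Fin m → Vec d}
    (hrun : S.IsRun β (1 / LF) init xc xg T θ J g) (j : Fin k) :
    ‖θ T j - S.opt j‖ ≤ (1 - lamF / (lamF + LF)) ^ T * ‖init j - S.opt j‖ + 2 / lamF * W := by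
  have hL0 : 0 < LF := hlam.trans_le hlL
  have hn0 : (0 : ℝ) < S.nmin := by exact_mod_cast hS.nmin_pos
  have hW0 : 0 ≤ W := by
    refine le_trans ?_ hW
    positivity
  set ρ := 1 - lamF / (lamF + LF) with hρ
  have hρ0 : 0 ≤ ρ := by
    rw [hρ, sub_nonneg, div_le_one (by positivity)]; linarith
  set R := 1 / 4 * √(lamF / LF) * S.Δ with hR
  -- The induction also carries membership in `Θ` and in the basin of radius `R`, which make the
  -- cluster estimates of the next step correct.
  suffices h : ∀ t ≤ T, ∀ j, θ t j ∈ S.Θ ∧ ‖θ t j - S.opt j‖ ≤ R ∧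
      ‖θ t j - S.opt j‖ ≤ ρ ^ t * ‖init j - S.opt j‖ + 2 / lamF * W from (h T le_rfl j).2.2
  intro t
  induction t with
  | zero =>
    intro _ j
    rw [hrun.start]
    refine ⟨hinit j, hclose j, ?_⟩
    have : 0 ≤ 2 / lamF * W := by positivity
    simpa using this
  | succ t ih =>
    intro ht j
    have htT : t < T := ht
    have ih' := ih htT.le
    have hJ : ∀ i ∈ S.normal, J t i = S.cl i := fun i hi =>
      (hxc t).estimate_eq hS hlam hlL hF hκ hgap hΔ (fun j => (ih' j).1) (fun j => (ih' j).2.1) hi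
        (hrun.estimate t htT i hi)
    have hag := ((hxg t).norm_trmean_sub_le hS hκ hε hβ0 hβ hα (fun j => (ih' j).1) hJ
      (hrun.grad t htT) j).trans hW
    have hstep := hrun.step t htT j
    have h1 := hstep.norm_sub_le hS.convex (hS.opt_mem j)
    have h2 := (hF j).1.gradient_step (hF j).2 hlam hlL (hS.opt_stat j) (θ t j)
    set v := trmean β (Finset.univ.filter (fun i => J t i = j)) (g t)
    set w := gradient (S.popLoss j) (θ t j)
    have h3 : ‖θ t j - (1 / LF) • v - S.opt j‖ ≤ ρ * ‖θ t j - S.opt j‖ + W / LF := by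
      have e : θ t j - (1 / LF) • v - S.opt j
          = (θ t j - (1 / LF) • w - S.opt j) - (1 / LF) • (v - w) := by
        rw [smul_sub]; abel
      rw [e]
      refine (norm_sub_le _ _).trans (add_le_add h2 ?_)
      rw [norm_smul, Real.norm_of_nonneg (by positivity), one_div, inv_mul_eq_div]
      gcongr
    have h4 := h1.trans h3
    refine ⟨hstep.1, h4.trans ?_, h4.trans ?_⟩
    · have h5 := mul_le_mul_of_nonneg_left (ih' j).2.1 hρ0
      have h6 : ρ * R = R - lamF / (lamF + LF) * R := by rw [hρ]; ring
      linarith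
    · have h5 := mul_le_mul_of_nonneg_left (ih' j).2.2 hρ0
      -- Contraction frees `2 W / (λ_F + L_F)`, which covers the new error `W / L_F` because `λ_F ≤
      -- L_F`.
      have h6 : ρ * (2 / lamF * W) + W / LF ≤ 2 / lamF * W := by
        have e1 : ρ * (2 / lamF * W) = 2 / lamF * W - 2 / (lamF + LF) * W := by
          rw [hρ]; field_simp
        have e2 : W / LF ≤ 2 / (lamF + LF) * W := by
          rw [div_mul_eq_mul_div, div_le_div_iff₀ hL0 (by positivity)]
          nlinarith
        linarith
      calc ρ * ‖θ t j - S.opt j‖ + W / LF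
          ≤ ρ * (ρ ^ t * ‖init j - S.opt j‖ + 2 / lamF * W) + W / LF := by linarith
        _ = ρ ^ (t + 1) * ‖init j - S.opt j‖ + (ρ * (2 / lamF * W) + W / LF) := by ring
        _ ≤ _ := by linarith

end Setup

end ByzIFCA

/-! ### Consequences of the separation of the clusters -/

namespace ByzIFCA

variable {d k m : ℕ} {Z : Type*} [MeasurableSpace Z] {S : Setup d k m Z}

namespace Setup

lemma Standing.exists_ne (hS : S.Standing) : ∃ j j' : Fin k, j ≠ j' :=
  ⟨⟨0, by have := hS.two_le; omega⟩, ⟨1, by have := hS.two_le; omega⟩, by simp⟩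

lemma Standing.two_le_N (hS : S.Standing) : 2 ≤ S.N :=
  hS.two_le.trans (hS.k_le_card_normal.trans hS.card_normal_le)

lemma Standing.half_le_log_N (hS : S.Standing) : 1 / 2 ≤ Real.log S.N := by
  have h1 : Real.log 2 ≤ Real.log S.N :=
    Real.log_le_log (by norm_num) (by exact_mod_cast hS.two_le_N)
  linarith [Real.log_two_gt_d9]

lemma Standing.Δ_le_D (hS : S.Standing) : S.Δ ≤ S.D := by
  obtain ⟨j, j', h⟩ := hS.exists_ne
  refine (Δ_le h).trans ?_
  rw [← dist_eq_norm]
  exact Metric.dist_le_diam_of_mem hS.compact.isBounded (hS.opt_mem j) (hS.opt_mem j')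

variable {C₀ C lamF LF η : ℝ} {init : Fin k → Vec d}

lemma Separated.Δ_le_two (hsep : S.Separated C₀ C lamF LF η init) (hS : S.Standing) :
    S.Δ ≤ 2 := by
  obtain ⟨j, j', h⟩ := hS.exists_ne
  refine (Δ_le h).trans ((norm_sub_le _ _).trans ?_)
  linarith [hsep.opt_norm j, hsep.opt_norm j']

lemma Separated.mul_rpow_le (hsep : S.Separated C₀ C lamF LF η init) (hS : S.Standing)
    (hC : 0 < C) : C * Real.log S.N * (S.nmin : ℝ) ^ (-(1 / 5 : ℝ)) ≤ S.Δ := by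
  have := hS.half_le_log_N
  refine le_trans ?_ hsep.separation
  gcongr
  exact le_max_left _ _

lemma Separated.Δ_pos (hsep : S.Separated C₀ C lamF LF η init) (hS : S.Standing)
    (hC : 0 < C) : 0 < S.Δ := by
  have h1 := hS.half_le_log_N
  have hn0 : (0 : ℝ) < S.nmin := by exact_mod_cast hS.nmin_pos
  refine lt_of_lt_of_le ?_ (hsep.mul_rpow_le hS hC)
  positivity

/-- Since `Δ ≤ 2`, the lower bound on `Δ` becomes one on `n_min`; this is how a large `C` forces
large samples. -/
lemma Separated.mul_log_le_nmin (hsep : S.Separated C₀ C lamF LF η init) (hS : S.Standing)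
    (hC : 0 < C) : C * Real.log S.N / 2 ≤ S.nmin := by
  have h1 := hS.half_le_log_N
  have hn1 : (1 : ℝ) ≤ S.nmin := by exact_mod_cast hS.nmin_pos
  have hn0 : (0 : ℝ) < S.nmin := by linarith
  have h2 := (hsep.mul_rpow_le hS hC).trans (hsep.Δ_le_two hS)
  rw [Real.rpow_neg hn0.le, ← div_eq_mul_inv, div_le_iff₀ (by positivity)] at h2
  have h3 : (S.nmin : ℝ) ^ (1 / 5 : ℝ) ≤ S.nmin := by
    calc (S.nmin : ℝ) ^ (1 / 5 : ℝ) ≤ (S.nmin : ℝ) ^ (1 : ℝ) :=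
          Real.rpow_le_rpow_of_exponent_le hn1 (by norm_num)
      _ = S.nmin := Real.rpow_one _
  linarith

lemma Separated.mul_log_div_sqrt_le (hsep : S.Separated C₀ C lamF LF η init) (hS : S.Standing)
    (hC : 0 < C) : C * Real.log S.N / √(S.nmin) ≤ S.Δ := by
  have h1 := hS.half_le_log_N
  have hn1 : (1 : ℝ) ≤ S.nmin := by exact_mod_cast hS.nmin_pos
  have hn0 : (0 : ℝ) < S.nmin := by linarith
  refine le_trans ?_ (hsep.mul_rpow_le hS hC)
  rw [Real.sqrt_eq_rpow, div_eq_mul_inv, ← Real.rpow_neg hn0.le]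
  have : (S.nmin : ℝ) ^ (-(1 / 2 : ℝ)) ≤ (S.nmin : ℝ) ^ (-(1 / 5 : ℝ)) :=
    Real.rpow_le_rpow_of_exponent_le hn1 (by norm_num)
  gcongr

/-- The loss gap scales as `Δ²`, hence at least as `n_min^(-2/5)`, and so dominates the gradient
deviation of order `n_min^(-1/2)`. -/
lemma Separated.mul_log_sq_div_sqrt_le (hsep : S.Separated C₀ C lamF LF η init)
    (hS : S.Standing) (hC : 0 < C) : C ^ 2 * Real.log S.N ^ 2 / √(S.nmin) ≤ S.Δ ^ 2 := by
  have h1 := hS.half_le_log_N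
  have hn1 : (1 : ℝ) ≤ S.nmin := by exact_mod_cast hS.nmin_pos
  have hn0 : (0 : ℝ) < S.nmin := by linarith
  refine le_trans ?_ (pow_le_pow_left₀ (by positivity) (hsep.mul_rpow_le hS hC) 2)
  rw [Real.sqrt_eq_rpow, div_eq_mul_inv, ← Real.rpow_neg hn0.le, mul_pow, mul_pow,
    ← Real.rpow_natCast ((S.nmin : ℝ) ^ (-(1 / 5 : ℝ))), ← Real.rpow_mul hn0.le]
  have : (S.nmin : ℝ) ^ (-(1 / 2 : ℝ)) ≤ (S.nmin : ℝ) ^ (-(1 / 5 : ℝ) * (2 : ℕ)) :=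
    Real.rpow_le_rpow_of_exponent_le hn1 (by norm_num)
  gcongr

lemma Separated.d_pos (hsep : S.Separated C₀ C lamF LF η init) (hS : S.Standing)
    (hC : 0 < C) : 0 < d := by
  rcases Nat.eq_zero_or_pos d with rfl | h
  · exfalso
    obtain ⟨j, j', h⟩ := hS.exists_ne
    have h1 := Δ_le (S := S) h
    rw [Subsingleton.elim (S.opt j) (S.opt j'), sub_self, norm_zero] at h1
    linarith [hsep.Δ_pos hS hC]
  · exact h

/-- Distinct clusters have distinct targets, so the smoothness and convexity moduli of the population
losses are ordered. -/
lemma PopRegular.le (hF : S.PopRegular lamF LF) (hS : S.Standing) (hΔ : 0 < S.Δ) :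
    lamF ≤ LF := by
  obtain ⟨j, j', h⟩ := hS.exists_ne
  refine (hF j).1.le_of_smooth (hF j).2 (x := S.opt j) (y := S.opt j') fun heq => ?_
  have h1 := Δ_le (S := S) h
  rw [heq, sub_self, norm_zero] at h1
  linarith

/-- The losses cannot all have constant gradient. -/
lemma PopRegular.sqrt_pos (hF : S.PopRegular lamF LF) (hS : S.Standing) (hΔ : 0 < S.Δ)
    (hlam : 0 < lamF) {L σ : ℝ} {Lh : Fin d → ℝ} (hL : S.LossRegular L Lh)
    (hsub : S.SubExpGradient σ) : 0 < √(∑ h, Lh h ^ 2) := by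
  rw [Real.sqrt_pos]
  by_contra hneg
  have hz : ∀ h, Lh h = 0 := by
    intro h
    have h0 : ∑ h, Lh h ^ 2 = 0 :=
      le_antisymm (not_lt.1 hneg) (Finset.sum_nonneg fun _ _ => sq_nonneg _)
    have := (Finset.sum_eq_zero_iff_of_nonneg fun _ _ => sq_nonneg _).1 h0 h (Finset.mem_univ h)
    exact pow_eq_zero_iff two_ne_zero |>.1 this
  obtain ⟨j, j', hne⟩ := hS.exists_ne
  have hg : gradient (S.popLoss j) (S.opt j) = gradient (S.popLoss j) (S.opt j') := by
    ext h
    have := abs_gradient_popLoss_sub_le hS hL j (fun h => (hsub j h _ (hS.opt_mem j)).1)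
      (fun h => (hsub j h _ (hS.opt_mem j')).1) h
    rw [hz h, zero_mul] at this
    exact sub_eq_zero.1 (abs_nonpos_iff.1 this)
  have h1 := (hF j).1.inner_le (S.opt j) (S.opt j')
  rw [hg, sub_self, inner_zero_left] at h1
  have h2 := hΔ.trans_le (Δ_le (S := S) hne)
  have : 0 < lamF * ‖S.opt j - S.opt j'‖ ^ 2 := by positivity
  linarith

end Setup

/-- The failure probability of the union bound is polynomially small. -/
lemma failure_probability_le {A N D Lf σ b : ℝ} {d : ℕ} (hd : 0 < d) (hA : 0 < A) (hσ : 0 < σ)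
    (hD : 0 ≤ D) (hLf : 0 ≤ Lf) (hN1 : 1 ≤ N) (hNd : 4 * d ≤ N)
    (hN : 2 * D * √d * Lf / σ + 1 ≤ N) (hb : b ≤ N ^ A) :
    4 * b * N * d * (2 * D * √d * (N * Lf) / σ + 1) ^ d
      * Real.exp (-((2 * A + 4) * d * Real.log N)) ≤ 1 / N ^ A := by
  have hN0 : 0 < N := by linarith
  have hd1 : (1 : ℝ) ≤ d := by exact_mod_cast hd
  have h1 : 2 * D * √d * (N * Lf) / σ + 1 ≤ N ^ 2 := by
    calc 2 * D * √d * (N * Lf) / σ + 1 = N * (2 * D * √d * Lf / σ) + 1 := by ring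
      _ ≤ N * (2 * D * √d * Lf / σ) + N * 1 := by linarith
      _ = N * (2 * D * √d * Lf / σ + 1) := by ring
      _ ≤ N * N := by gcongr
      _ = N ^ 2 := by ring
  have h2 : Real.exp (-((2 * A + 4) * d * Real.log N)) = N ^ (-((2 * A + 4) * d)) := by
    rw [Real.rpow_def_of_pos hN0]
    congr 1
    ring
  have h3 : (2 * D * √d * (N * Lf) / σ + 1) ^ d ≤ N ^ (2 * d : ℝ) := by
    refine (pow_le_pow_left₀ (by positivity) h1 d).trans_eq ?_
    rw [← pow_mul, ← Real.rpow_natCast]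
    push_cast
    rfl
  rw [h2]
  calc 4 * b * N * d * (2 * D * √d * (N * Lf) / σ + 1) ^ d * N ^ (-((2 * A + 4) * d))
      = b * N * (4 * d) * (2 * D * √d * (N * Lf) / σ + 1) ^ d * N ^ (-((2 * A + 4) * d)) := by
        ring
    _ ≤ N ^ A * N * N * N ^ (2 * d : ℝ) * N ^ (-((2 * A + 4) * d)) := by gcongr
    _ = N ^ (A + 1 + 1 + 2 * d + -((2 * A + 4) * d)) := by
        rw [Real.rpow_add hN0, Real.rpow_add hN0, Real.rpow_add hN0, Real.rpow_add hN0,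
          Real.rpow_one]
    -- The exponent `A + 2 + 2d - (2A + 4)d` is at most `-A` precisely because `d ≥ 1`.
    _ ≤ N ^ (-A) := by
        apply Real.rpow_le_rpow_of_exponent_le hN1
        nlinarith
    _ = 1 / N ^ A := by rw [Real.rpow_neg hN0.le, one_div]

/-- Trades the `√(log N)` of the deviation for the `(log N)²` of the squared separation; `1/2` is a
lower bound for `log N` when `N ≥ 2`. -/
lemma sqrt_log_le {x : ℝ} (hx : 1 / 2 ≤ x) : √x ≤ 4 * x ^ 2 := by
  rw [Real.sqrt_le_left (by positivity)]
  nlinarith [sq_nonneg (x ^ 2), mul_self_nonneg (x - 1 / 2), pow_le_pow_left₀ (by norm_num) hx 3]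

/-- After logarithmically many steps the geometric term is dominated. -/
lemma pow_mul_le_of_log_le {a L W r R : ℝ} {T : ℕ} (ha : 0 < a) (haL : a ≤ L) (hW : 0 < W)
    (hr : 0 ≤ r) (hrR : r ≤ R) (hT : (L + a) / a * Real.log (a / (2 * W) * R) ≤ T) :
    (1 - a / (a + L)) ^ T * r ≤ 2 * W / a := by
  have hL : 0 < L := ha.trans_le haL
  rcases hr.eq_or_lt with h | h
  · rw [← h, mul_zero]; positivity
  have hR : 0 < R := h.trans_le hrR
  have h0 : 0 ≤ 1 - a / (a + L) := by
    rw [sub_nonneg, div_le_one (by positivity)]; linarith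
  have h1 : (1 - a / (a + L)) ^ T ≤ Real.exp (-(a / (a + L)) * T) := by
    rw [mul_comm, Real.exp_nat_mul]
    exact pow_le_pow_left₀ h0 (Real.one_sub_le_exp_neg _) T
  have h2 : Real.log (a / (2 * W) * R) ≤ a / (a + L) * T := by
    have h3 : a / (a + L) * ((L + a) / a * Real.log (a / (2 * W) * R))
        = Real.log (a / (2 * W) * R) := by
      field_simp
      ring
    rw [← h3]
    gcongr
  have h4 : Real.exp (-(a / (a + L)) * T) ≤ (a / (2 * W) * R)⁻¹ := by
    rw [← Real.exp_log (by positivity : 0 < a / (2 * W) * R), ← Real.exp_neg, Real.exp_le_exp]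
    linarith
  calc (1 - a / (a + L)) ^ T * r ≤ (a / (2 * W) * R)⁻¹ * R := by
        gcongr
        exact h1.trans h4
    _ = 2 * W / a := by field_simp

end ByzIFCA

/-! ### Choice of constants and the main theorem -/

namespace ByzIFCA

/-- The aggregation error on concentrated samples in terms of the error of the theorem. -/
lemma aggregation_error_le {A σ ε β u v x ℓ : ℝ} {d : ℕ} (hA : 0 < A) (hσ : 0 < σ) (hε : 0 < ε)
    (hβ : 0 ≤ β) (hu : 0 ≤ u) (hv : 0 ≤ v) (hxℓ : x ≤ 2 * ℓ) :
    √d * ((3 * σ * √(2 * ((2 * A + 4) * d * x)) / u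
        + 3 * β * (3 * σ * √(2 * ((2 * A + 4) * d * x)) / v)) / (2 * ε)) ≤
      9 / 2 * √(8 * A + 16) * (σ * d / ε * (β / v + 1 / u) * √ℓ) := by
  have h1 : √d * √(2 * ((2 * A + 4) * d * x)) ≤ d * (√(8 * A + 16) * √ℓ) := by
    rw [← Real.sqrt_mul (by positivity), ← Real.sqrt_mul (by positivity)]
    calc √(d * (2 * ((2 * A + 4) * d * x))) ≤ √((d : ℝ) ^ 2 * ((8 * A + 16) * ℓ)) := by
          apply Real.sqrt_le_sqrt
          have : (2 * A + 4) * x ≤ (2 * A + 4) * (2 * ℓ) := by gcongr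
          nlinarith [mul_le_mul_of_nonneg_left this (sq_nonneg (d : ℝ))]
      _ = d * √((8 * A + 16) * ℓ) := by
          rw [Real.sqrt_mul (by positivity), Real.sqrt_sq (by positivity)]
  -- The trimming term gives `3 · 3 / 2 = 9 / 2`; the averaging term carries a third of that, which
  -- is rounded up.
  calc _ = √d * √(2 * ((2 * A + 4) * d * x)) * (9 / 2 * σ / ε * (β / v + 1 / u * (1 / 3))) := by
        ring
    _ ≤ d * (√(8 * A + 16) * √ℓ) * (9 / 2 * σ / ε * (β / v + 1 / u * 1)) := by
        gcongr
        norm_num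
    _ = _ := by ring

lemma one_le_deviation_level {A x : ℝ} {d : ℕ} (hA : 0 < A) (hd : (1 : ℝ) ≤ d) (hx : 1 / 2 ≤ x) :
    1 ≤ 2 * ((2 * A + 4) * d * x) := by
  have h1 : 1 * (1 / 2) ≤ (d : ℝ) * x := by gcongr
  have h2 : 4 * (1 * (1 / 2)) ≤ (2 * A + 4) * ((d : ℝ) * x) := by
    gcongr
    linarith
  linarith

lemma deviation_level_lt {A C x n : ℝ} {d : ℕ} (hx : 1 / 2 ≤ x) (hC : (8 * A + 16) * d < C)
    (hn : C * x / 2 ≤ n) : 2 * ((2 * A + 4) * d * x) < n := by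
  have h1 : (8 * A + 16) * d * x < C * x := by gcongr
  linarith

/-- The deviation level involves `log N`, the error of the theorem `log (N L_f D)`. This and its
converse below make them comparable once `N` is large, even if `L_f D` is small. -/
lemma log_le_two_mul_log {N Λ D : ℝ} (hN : 1 ≤ N) (hΛ : 0 < Λ) (hD : 0 < D)
    (h : 1 / (Λ * D) ^ 2 ≤ N) : Real.log N ≤ 2 * Real.log (N * Λ * D) := by
  have h1 : 2 * Real.log (N * Λ * D) = Real.log ((N * Λ * D) ^ 2) := by
    rw [Real.log_pow]; push_cast; rfl
  rw [h1]
  refine Real.log_le_log (by linarith) ?_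
  rw [div_le_iff₀ (by positivity)] at h
  calc N = N * 1 := (mul_one _).symm
    _ ≤ N * (N * (Λ * D) ^ 2) := by gcongr
    _ = (N * Λ * D) ^ 2 := by ring

lemma log_mul_le_two_mul_log {N Λ D : ℝ} (hN : 1 ≤ N) (hΛ : 0 < Λ) (hD : 0 < D)
    (h : Λ * D ≤ N) : Real.log (N * Λ * D) ≤ 2 * Real.log N := by
  have h1 : 2 * Real.log N = Real.log (N ^ 2) := by rw [Real.log_pow]; push_cast; rfl
  rw [h1]
  refine Real.log_le_log (by positivity) ?_
  calc N * Λ * D = N * (Λ * D) := mul_assoc _ _ _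
    _ ≤ N * N := by gcongr
    _ = N ^ 2 := (sq N).symm

/-- The single-machine deviation is small compared with the separation of the losses. -/
lemma deviation_lt_gap {A σ D C lamF x s Δ : ℝ} {d : ℕ} (hA : 0 < A) (hσ : 0 < σ) (hD : 0 < D)
    (hlam : 0 < lamF) (hC1 : 1 ≤ C) (hC : 48 * σ * D * √d * √((4 * A + 8) * d) / lamF < C)
    (hx : 1 / 2 ≤ x) (hs : 0 < s) (hΔ : C ^ 2 * x ^ 2 / s ≤ Δ ^ 2) :
    √d * (3 * σ * √(2 * ((2 * A + 4) * d * x)) / s) * D < lamF * Δ ^ 2 / 4 := by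
  have h1 : √(2 * ((2 * A + 4) * d * x)) ≤ √((4 * A + 8) * d) * (4 * x ^ 2) := by
    rw [show 2 * ((2 * A + 4) * d * x) = (4 * A + 8) * d * x by ring, Real.sqrt_mul (by positivity)]
    gcongr
    exact sqrt_log_le hx
  have h2 : 48 * σ * D * √d * √((4 * A + 8) * d) < lamF * C ^ 2 := by
    rw [div_lt_iff₀ hlam] at hC
    refine hC.trans_le ?_
    rw [mul_comm]
    gcongr
    exact le_self_pow₀ hC1 two_ne_zero
  calc √d * (3 * σ * √(2 * ((2 * A + 4) * d * x)) / s) * D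
      = 3 * σ * D * √d * √(2 * ((2 * A + 4) * d * x)) / s := by ring
    _ ≤ 3 * σ * D * √d * (√((4 * A + 8) * d) * (4 * x ^ 2)) / s := by gcongr
    _ = (48 * σ * D * √d * √((4 * A + 8) * d)) * (x ^ 2 / s) / 4 := by ring
    _ < lamF * C ^ 2 * (x ^ 2 / s) / 4 := by gcongr
    _ = lamF * (C ^ 2 * x ^ 2 / s) / 4 := by ring
    _ ≤ lamF * Δ ^ 2 / 4 := by gcongr

/-- The aggregation error does not drive the iterates out of the basin of attraction. -/
lemma aggregation_error_le_separation {σ ε β u v x ℓ K LF q C Δ : ℝ} {d : ℕ} (hσ : 0 < σ)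
    (hε : 0 < ε) (hK : 0 ≤ K) (hLF : 0 < LF) (hq : 0 < q) (hβ : β ≤ 1) (hv : 0 < v)
    (hvu : v ≤ u) (hx : 1 / 2 ≤ x) (hℓ : ℓ ≤ 2 * x) (hC : 8 * K * σ * d / (ε * LF * q) ≤ C)
    (hΔ : C * x / v ≤ Δ) :
    K * (σ * d / ε * (β / v + 1 / u) * √ℓ) / LF ≤ q * Δ := by
  have h1 : β / v + 1 / u ≤ 2 / v := by
    have h3 : 1 / u ≤ 1 / v := by gcongr
    have h4 : β / v ≤ 1 / v := by gcongr
    rw [show 2 / v = 1 / v + 1 / v by ring]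
    linarith
  have hu : 0 < u := hv.trans_le hvu
  have h2 : √ℓ ≤ 4 * x := by
    rw [Real.sqrt_le_left (by linarith)]
    nlinarith
  rw [div_le_iff₀ (by positivity)] at hC
  calc K * (σ * d / ε * (β / v + 1 / u) * √ℓ) / LF
      ≤ K * (σ * d / ε * (2 / v) * (4 * x)) / LF := by gcongr
    _ = 8 * K * σ * d * (x / (v * ε * LF)) := by field_simp; ring
    _ ≤ C * (ε * LF * q) * (x / (v * ε * LF)) := by gcongr
    _ = q * (C * x / v) := by field_simp
    _ ≤ q * Δ := by gcongr

lemma exists_separation_const (a₁ a₂ a₃ a₄ a₅ a₆ a₇ : ℝ) :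
    ∃ C : ℝ, 1 ≤ C ∧ a₁ ≤ C ∧ a₂ ≤ C ∧ a₃ ≤ C ∧ a₄ ≤ C ∧ a₅ < C ∧ a₆ < C ∧ a₇ ≤ C := by
  refine ⟨1 + |a₁| + |a₂| + |a₃| + |a₄| + |a₅| + |a₆| + |a₇|, ?_⟩
  refine ⟨?_, ?_, ?_, ?_, ?_, ?_, ?_, ?_⟩ <;>
  linarith [le_abs_self a₁, le_abs_self a₂, le_abs_self a₃, le_abs_self a₄, le_abs_self a₅,
    le_abs_self a₆, le_abs_self a₇, abs_nonneg a₁, abs_nonneg a₂, abs_nonneg a₃, abs_nonneg a₄,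
    abs_nonneg a₅, abs_nonneg a₆, abs_nonneg a₇]

/-- The error bound in terms of the fraction of Byzantine machines. -/
lemma four_mul_error_div_le {K σ ε α p c v u s lamF β : ℝ} {d : ℕ} (hK : 0 ≤ K) (hσ : 0 < σ)
    (hε : 0 < ε) (hα : 0 ≤ α) (hp : 0 < p) (hc : 0 < c) (hv : 0 ≤ v) (hu : 0 ≤ u) (hs : 0 ≤ s)
    (hlam : 0 < lamF) (hβ : 4 * α / p = c * β) :
    4 * (K * (σ * d / ε * (β / v + 1 / u) * s)) / lamF ≤
      4 * K / lamF * (σ / ε) * max 1 (4 / c) * (α * d / (p * v) + d / u) * s := by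
  have hβc : β = 4 / c * (α / p) := by
    field_simp
    field_simp at hβ
    linarith
  have hM1 : 1 ≤ max 1 (4 / c) := le_max_left _ _
  have hMc : 4 / c ≤ max 1 (4 / c) := le_max_right _ _
  set M := max 1 (4 / c)
  calc 4 * (K * (σ * d / ε * (β / v + 1 / u) * s)) / lamF
      = 4 * K / lamF * (σ / ε) * d * (4 / c * (α / p / v) + 1 * (1 / u)) * s := by
        rw [hβc]; ring
    _ ≤ 4 * K / lamF * (σ / ε) * d * (M * (α / p / v) + M * (1 / u)) * s := by gcongr
    _ = 4 * K / lamF * (σ / ε) * M * (α * d / (p * v) + d / u) * s := by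
        rw [← div_div (α * d)]
        ring

end ByzIFCA

theorem theorem2 :
    ∃ c₁ : ℝ, 0 < c₁ ∧
    ∀ A : ℝ, 0 < A →
    ∃ K C₀ : ℝ, 0 < K ∧ 0 < C₀ ∧
    ∀ (d : ℕ) (lamF LF σ ε D : ℝ) (Lh : Fin d → ℝ),
      0 < lamF → 0 < LF → 0 < σ → 0 < ε → (∀ h, 0 ≤ Lh h) →
    ∃ C : ℝ, 0 < C ∧
    ∀ (k m b : ℕ) (Z : Type*) [MeasurableSpace Z] (Ω : Type*) [MeasurableSpace Ω]
      (P : Measure Ω) [IsProbabilityMeasure P]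
      (S : ByzIFCA.Setup d k m Z) (init : Fin k → ByzIFCA.Vec d)
      (z : Fin b → (i : Fin m) → Fin (S.n i) → Ω → Z)
      (bc bg : ℕ → Fin b) (L η β δ Lf : ℝ),
      S.Standing →
      S.D = D →
      Lf = √(∑ h, Lh h ^ 2) →
      S.PopRegular lamF LF →
      S.LossRegular L Lh →
      S.BoundedVariance η →
      S.Separated C₀ C lamF LF η init →
      S.SubExpGradient σ →
      S.IsData P z →
      (b : ℝ) ≤ (S.N : ℝ) ^ A →
      0 < δ →
      4 * c₁ * η ^ 2 / (S.p * δ * lamF ^ 2 * S.Δ ^ 4 * S.nmin) + 4 * S.alpha / S.p ≤ β →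
      β ≤ 1 / 2 - ε →
      ∃ G : Set Ω, MeasurableSet G ∧
        1 - δ - 1 / (S.N : ℝ) ^ A
          - 4 * d / (1 + 1 / 4 * S.p * m * S.nmin * Lf * D) ^ d ≤ P.real G ∧
        ∀ ω ∈ G, ∀ (T : ℕ) (θ : ℕ → Fin k → ByzIFCA.Vec d) (J : ℕ → Fin m → Fin k)
          (g : ℕ → Fin m → ByzIFCA.Vec d),
          S.IsRun β (1 / LF) init (fun t i l => z (bc t) i l ω) (fun t i l => z (bg t) i l ω)
            T θ J g →
          (∀ j, ‖θ T j - S.opt j‖ ≤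
            (1 - lamF / (lamF + LF)) ^ T * ‖init j - S.opt j‖
              + 2 / lamF * S.err K σ ε β Lf) ∧
          ((LF + lamF) / lamF *
              Real.log (lamF / (2 * S.err K σ ε β Lf) * ⨆ j, ‖init j - S.opt j‖) ≤ (T : ℝ) →
            (∀ j, ‖θ T j - S.opt j‖ ≤ 4 * S.err K σ ε β Lf / lamF) ∧
            ∀ c : ℝ, 0 < c → 4 * S.alpha / S.p = c * β →
              ∀ j, ‖θ T j - S.opt j‖ ≤
                4 * K / lamF * (σ / ε) * max 1 (4 / c)
                  * (S.alpha * d / (S.p * √(S.nmin : ℝ)) + d / √(S.p * m * S.nmin))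
                  * √(Real.log (S.N * Lf * D))) := by
  -- `K` is the factor from `aggregation_error_le`. Any positive `c₁` and `C₀` would do, since
  -- misjudged clusters are excluded by the choice of `C`.
  refine ⟨1, one_pos, fun A hA => ⟨9 / 2 * √(8 * A + 16), 1, by positivity, one_pos, ?_⟩⟩
  intro d lamF LF σ ε D Lh hlam hLF hσ hε hLh
  -- The first four bounds pass to `N` through `C ≤ 4 N`, hence their factor 4: they control the
  -- coordinate count, the net size and both comparisons of logarithms. The fifth keeps `2 t <
  -- n_min`, the sixth makes deviations smaller than the loss gap, the seventh keeps iterates in the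
  -- basin.
  obtain ⟨C, hC1, hC₁, hC₂, hC₃, hC₄, hC₅, hC₆, hC₇⟩ := ByzIFCA.exists_separation_const
    (4 * (4 * (d : ℝ))) (4 * (2 * D * √d * √(∑ h, Lh h ^ 2) / σ + 1))
    (4 * (1 / (√(∑ h, Lh h ^ 2) * D) ^ 2)) (4 * (√(∑ h, Lh h ^ 2) * D)) ((8 * A + 16) * d)
    (48 * σ * D * √d * √((4 * A + 8) * d) / lamF)
    (8 * (9 / 2 * √(8 * A + 16)) * σ * d /
      (ε * LF * (lamF / (lamF + LF) * (1 / 4 * √(lamF / LF)))))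
  have hC : 0 < C := by linarith
  refine ⟨C, hC, ?_⟩
  intro k m b Z _ Ω _ P _ S init z bc bg L η β δ Λ hS hD hΛ hF hL _ hsep hsub hz hb hδ hβl hβu
  subst hD
  rw [← hΛ] at hC₂ hC₃ hC₄
  have hΔ := hsep.Δ_pos hS hC
  have hlL := hF.le hS hΔ
  have hΛ0 : 0 < Λ := hΛ ▸ hF.sqrt_pos hS hΔ hlam hL hsub
  have hd := hsep.d_pos hS hC
  have hd1 : (1 : ℝ) ≤ d := by exact_mod_cast hd
  have hD0 : 0 < S.D := hΔ.trans_le hS.Δ_le_D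
  have hx := hS.half_le_log_N
  have hn1 : (1 : ℝ) ≤ S.nmin := by exact_mod_cast hS.nmin_pos
  have hnN : (S.nmin : ℝ) ≤ S.N := by exact_mod_cast hS.nmin_le_N
  have hN1 : (1 : ℝ) ≤ S.N := hn1.trans hnN
  have hpm := hS.one_le_p_mul
  have hm : (0 : ℝ) < m := by exact_mod_cast hS.m_pos
  have hp : 0 < S.p := pos_of_mul_pos_left (one_pos.trans_le hpm) hm.le
  have hCn := hsep.mul_log_le_nmin hS hC
  have hCN : C ≤ 4 * S.N := by
    have h1 : C * (1 / 2) ≤ C * Real.log S.N := by gcongr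
    linarith
  have hα0 : 0 ≤ S.alpha := by unfold ByzIFCA.Setup.alpha; positivity
  have hfst : 0 ≤ 4 * 1 * η ^ 2 / (S.p * δ * lamF ^ 2 * S.Δ ^ 4 * S.nmin) := by positivity
  have hαβ : 4 * S.alpha / S.p ≤ β := by linarith
  have hβ0 : 0 ≤ β := le_trans (by positivity) hαβ
  have hα : S.alpha ≤ β * S.p := by
    rw [div_le_iff₀ hp] at hαβ
    linarith
  have hxℓ := ByzIFCA.log_le_two_mul_log hN1 hΛ0 hD0 (by linarith)
  have hℓx := ByzIFCA.log_mul_le_two_mul_log hN1 hΛ0 hD0 (by linarith)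
  have hℓ0 : 0 < Real.log (S.N * Λ * S.D) := by linarith
  have hK0 : 0 < 9 / 2 * √(8 * A + 16) := by positivity
  have hvu : √(S.nmin : ℝ) ≤ √(S.p * m * S.nmin) :=
    Real.sqrt_le_sqrt (le_mul_of_one_le_left (by linarith) hpm)
  have ht1 := ByzIFCA.one_le_deviation_level hA hd1 hx
  have htn := ByzIFCA.deviation_level_lt hx hC₅ hCn
  have hgap := ByzIFCA.deviation_lt_gap hA hσ hD0 hlam hC1 hC₆ hx (Real.sqrt_pos.2 (by linarith))
    (hsep.mul_log_sq_div_sqrt_le hS hC)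
  have hWagg := ByzIFCA.aggregation_error_le (d := d) hA hσ hε hβ0
    (Real.sqrt_nonneg (S.p * m * S.nmin)) (Real.sqrt_nonneg S.nmin) hxℓ
  have hWΔ := ByzIFCA.aggregation_error_le_separation (β := β) hσ hε hK0.le hLF (by positivity)
    (by linarith) (Real.sqrt_pos.2 (by linarith)) hvu hx hℓx hC₇ (hsep.mul_log_div_sqrt_le hS hC)
  rw [mul_assoc (lamF / (lamF + LF))] at hWΔ
  have hPbad := (hz.measure_not_concentrated_le hS hd hL hσ hsub ht1 htn hLh (hΛ ▸ hΛ0)).trans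
    (ENNReal.ofReal_le_ofReal (ByzIFCA.failure_probability_le hd hA hσ hD0.le (hΛ ▸ hΛ0.le) hN1
      (by linarith) (by rw [← hΛ]; linarith) hb))
  have hKd : (0 : ℝ) < d := by linarith
  have hW0 : 0 < S.err (9 / 2 * √(8 * A + 16)) σ ε β Λ := by
    unfold ByzIFCA.Setup.err
    positivity
  set κ := 3 * σ * √(2 * ((2 * A + 4) * d * Real.log S.N)) with hκ
  have hκ0 : 0 ≤ κ := by positivity
  set K := 9 / 2 * √(8 * A + 16)
  set bad := {ω | ¬ ∀ r, S.Concentrated L Lh κ (fun i l => z r i l ω)}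
  -- The bad event involves all of `Θ` and need not be measurable, so its measurable hull is removed
  -- instead.
  refine ⟨(toMeasurable P bad)ᶜ, (measurableSet_toMeasurable _ _).compl, ?_, ?_⟩
  · rw [probReal_compl_eq_one_sub (measurableSet_toMeasurable _ _)]
    have h1 : P.real (toMeasurable P bad) ≤ 1 / (S.N : ℝ) ^ A := by
      rw [measureReal_def, measure_toMeasurable]
      exact ENNReal.toReal_le_of_le_ofReal (by positivity) hPbad
    have h2 : 0 ≤ 4 * (d : ℝ) / (1 + 1 / 4 * S.p * m * S.nmin * Λ * S.D) ^ d := by positivity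
    linarith
  intro ω hω T θ J g hrun
  have hconc : ∀ r, S.Concentrated L Lh κ (fun i l => z r i l ω) := by
    by_contra hcon
    exact hω (subset_toMeasurable P bad hcon)
  have hmain := fun j => hrun.norm_sub_opt_le hS hlam hlL hF hκ0 hgap hΔ.le hε hβ0 hβu hα hWagg hWΔ
    hsep.init_mem hsep.init_close (fun t => hconc (bc t)) (fun t => hconc (bg t)) j
  refine ⟨hmain, fun hT => ?_⟩
  have hfour : ∀ j, ‖θ T j - S.opt j‖ ≤ 4 * S.err K σ ε β Λ / lamF := by
    intro j
    have h1 := ByzIFCA.pow_mul_le_of_log_le hlam hlL hW0 (norm_nonneg (init j - S.opt j))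
      (le_ciSup (f := fun j => ‖init j - S.opt j‖) (Set.finite_range _).bddAbove j) hT
    have h2 := hmain j
    unfold ByzIFCA.Setup.err at h1 ⊢
    refine h2.trans ((add_le_add_left h1 _).trans_eq ?_)
    ring
  exact ⟨hfour, fun c hc hcβ j => (hfour j).trans (ByzIFCA.four_mul_error_div_le hK0.le hσ hε hα0 hp
    hc (Real.sqrt_nonneg _) (Real.sqrt_nonneg _) (Real.sqrt_nonneg _) hlam hcβ)⟩
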